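/- A *relational schema* is a set of relation names $R$, each with an arity $\mathrm{ar}(R)\ge 1$; a *fact* is an expression $R(c_1,\dots,c_{\mathrm{ar}(R)})$ with constants $c_i$, and a *database* $D$ is a finite set of facts. A (Boolean) $\mathrm{CQ}^{\neg}$ is a query $\exists \bar x\,(\alpha_1\wedge\dots\wedge\alpha_n)$ in which every $\alpha_i$ is an atom $R(\bar t)$, a negated atom $\neg R(\bar t)$, or an inequality $t\neq t'$, with terms that are constants or variables, such that every variable of a negated atom or of an inequality also occurs in a non-negated atom; a $\mathrm{UCQ}^{\neg}$ is a finite disjunction of $\mathrm{CQ}^{\neg}$s. For a $\mathrm{UCQ}^{\neg}$ $q$ let $q^{\pm}$ be the negation-free query obtained by replacing each negated atom $\neg R(\bar t)$ by $R^{-}(\bar t)$ and each non-negated atom $R(\bar t)$ by $R^{+}(\bar t)$, where $R^{+},R^{-}$ are new relation names, and keeping the inequalities. For a database $D$ let $D^{-}$ be the set of facts $R(\bar c)\notin D$ all of whose constants occur in $D$. A set $S\subseteq D$ is a *positive support* of $q$ in $D$ if $\{R^{+}(\bar c) : R(\bar c)\in S\}\cup\{R^{-}(\bar c) : R(\bar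 c)\in D^{-}\}\models q^{\pm}$, and it is *minimal* if no proper subset of it is a positive support of $q$ in $D$. For $B\subseteq D$ let $\xi_q(B)$ be the number of minimal positive supports of $q$ in $D$ that are contained in $B$. The *MPS-Shapley value* of a fact $\alpha\in D$ is the average of $$\xi_q(\{\beta\in D:\beta<\alpha\}\cup\{\alpha\})-\xi_q(\{\beta\in D:\beta<\alpha\})$$ over all linear orderings $<$ of $D$. **Proposition.** For every fixed $\mathrm{UCQ}^{\neg}$ $q$, the MPS-Shapley value is computable in polynomial time in data complexity: for every fixed naming of the relation names and of the constants by pairwise distinct bit strings, the MPS-Shapley value of every fact $\alpha$ of every database $D$ is rational, and there is a (multi-stack) Turing machine that, given $\alpha$ and a list of the facts of $D$ in any order without repetition, outputs this value as a fraction in lowest terms, written in binary, within a number of steps that is polynomial in the length of the input. -/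

import Mathlib

namespace DB

/-- A relational schema: relation names with positive arities. Finiteness is not demanded, so that
the case of a fixed finite schema and the case where each input database comes with its own finite
set of relation names (taken from a common infinite supply) are both covered. -/
structure Schema where
  Rel : Type
  arity : Rel → ℕ
  arity_pos : ∀ R, 0 < arity R

/-- `R(t₁, …, tₖ)` where `k` is the arity of `R` and the `tᵢ` are taken from `T`. -/
@[ext]
structure Atom (σ : Schema) (T : Type*) where
  rel : σ.Rel
  args : Fin (σ.arity rel) → T

/-- A fact is an atom that contains only constants. A database is a finite set of facts. -/
abbrev Fact (σ : Schema) (Const : Type*) := Atom σ Const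

/-- Terms are constants or variables. -/
inductive Term (Const Var : Type*) where
  | const (c : Const)
  | var (x : Var)

/-- Application of a function to all arguments of an atom. -/
def Atom.map {σ : Schema} {T U : Type*} (g : T → U) (a : Atom σ T) : Atom σ U :=
  ⟨a.rel, fun i => g (a.args i)⟩

/-- The value of a term under a valuation of the variables. -/
def Term.eval {Const Var : Type*} (ν : Var → Const) : Term Const Var → Const
  | .const c => c
  | .var x => ν x

/-- The variable `x` occurs in the atom `a`. -/
def Atom.HasVar {σ : Schema} {Const Var : Type*} (a : Atom σ (Term Const Var)) (x : Var) : Prop :=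
  ∃ i, a.args i = Term.var x

/-- A Boolean conjunctive query with safe negated atoms and inequalities: the existential closure
of the conjunction of the atoms in `pos`, the negations of the atoms in `neg`, and the inequalities
`t ≠ t'` for `(t, t')` in `ineq`. -/
structure CQNeg (σ : Schema) (Const Var : Type*) where
  pos : List (Atom σ (Term Const Var))
  neg : List (Atom σ (Term Const Var))
  ineq : List (Term Const Var × Term Const Var)
  safe_neg : ∀ a ∈ neg, ∀ x, a.HasVar x → ∃ b ∈ pos, b.HasVar x
  safe_ineq : ∀ e ∈ ineq, ∀ x, e.1 = .var x ∨ e.2 = .var x → ∃ b ∈ pos, b.HasVar x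

/-- Finite unions (disjunctions) of conjunctive queries with negation. -/
abbrev UCQNeg (σ : Schema) (Const Var : Type*) := List (CQNeg σ Const Var)

/-- `S ⊨ p` for a set of facts `S`. By safety, every variable of `p` is mapped to a constant that
occurs in `S`, so that it does not matter which larger set of constants valuations range over. -/
def CQNeg.Sat {σ : Schema} {Const Var : Type*} (p : CQNeg σ Const Var)
    (S : Set (Fact σ Const)) : Prop :=
  ∃ ν : Var → Const,
    (∀ a ∈ p.pos, a.map (Term.eval ν) ∈ S) ∧
    (∀ a ∈ p.neg, a.map (Term.eval ν) ∉ S) ∧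
    (∀ e ∈ p.ineq, e.1.eval ν ≠ e.2.eval ν)

/-- `S ⊨ q` for a union `q`. -/
def UCQNeg.Sat {σ : Schema} {Const Var : Type*} (q : UCQNeg σ Const Var)
    (S : Set (Fact σ Const)) : Prop :=
  ∃ p ∈ q, CQNeg.Sat p S

/-- The two signs `+` and `−` of signed relation names. -/
inductive Sgn where
  | plus
  | minus

/-- The signed schema, with relation names `R⁺` and `R⁻` of the arity of `R`, for every `R`. -/
def Schema.signed (σ : Schema) : Schema where
  Rel := Sgn × σ.Rel
  arity R := σ.arity R.2
  arity_pos R := σ.arity_pos R.2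

/-- The signed atom `R⁺(t)` or `R⁻(t)` of an atom `R(t)`. -/
def Atom.sign {σ : Schema} {T : Type*} (s : Sgn) (a : Atom σ T) : Atom σ.signed T :=
  ⟨(s, a.rel), a.args⟩

/-- The negation-free query over the signed schema obtained from `p` by replacing each positive
atom `R(t)` by `R⁺(t)` and each negated atom `¬ R(t)` by `R⁻(t)`, and keeping the inequalities. -/
def CQNeg.signed {σ : Schema} {Const Var : Type*} (p : CQNeg σ Const Var) :
    CQNeg σ.signed Const Var where
  pos := p.pos.map (Atom.sign .plus) ++ p.neg.map (Atom.sign .minus)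
  neg := []
  ineq := p.ineq
  safe_neg := by simp
  safe_ineq := by
    intro e he x hx
    obtain ⟨b, hb, hbx⟩ := p.safe_ineq e he x hx
    exact ⟨b.sign .plus, List.mem_append_left _ (List.mem_map_of_mem hb), hbx⟩

/-- The signed version of a union, taken disjunct by disjunct. -/
def UCQNeg.signed {σ : Schema} {Const Var : Type*} (q : UCQNeg σ Const Var) :
    UCQNeg σ.signed Const Var :=
  q.map CQNeg.signed

/-- The active domain of a database. -/
def activeDomain {σ : Schema} {Const : Type*} (D : Finset (Fact σ Const)) : Set Const :=
  {c | ∃ f ∈ D, ∃ i, f.args i = c}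

/-- The facts over the active domain of `D` that are absent from `D`. -/
def negFacts {σ : Schema} {Const : Type*} (D : Finset (Fact σ Const)) : Set (Fact σ Const) :=
  {f | (∀ i, f.args i ∈ activeDomain D) ∧ f ∉ D}

/-- `S ⊆ D` is a positive support of `q` in `D` if the signed version of `q` holds in the set of
all `f⁺` with `f ∈ S` and all `f⁻` with `f` a fact over the active domain of `D` absent
from `D`. -/
def IsPositiveSupport {σ : Schema} {Const Var : Type*} (q : UCQNeg σ Const Var)
    (D S : Finset (Fact σ Const)) : Prop :=
  S ⊆ D ∧ UCQNeg.Sat (UCQNeg.signed q)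
    (Atom.sign .plus '' (S : Set (Fact σ Const)) ∪ Atom.sign .minus '' negFacts D)

/-- Minimality is with respect to set inclusion. -/
def IsMinimalPositiveSupport {σ : Schema} {Const Var : Type*} (q : UCQNeg σ Const Var)
    (D S : Finset (Fact σ Const)) : Prop :=
  Minimal (IsPositiveSupport q D) S

open scoped Classical in
/-- The Shapley value of `α ∈ D` for the wealth function `ξ`: the average, over all linear
orderings of `D`, of `ξ({β ∈ D | β < α} ∪ {α}) - ξ({β ∈ D | β < α})`. A linear ordering of `D` is
given as the bijection `π` that maps each element of `D` to its position. -/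
noncomputable def shapley {F : Type*} (D : Finset F) (ξ : Finset F → ℝ) (α : D) : ℝ :=
  (∑ π : D ≃ Fin D.card,
      (ξ (insert (α : F) ((Finset.univ.filter fun β : D => π β < π α).map
          (Function.Embedding.subtype _)))
        - ξ ((Finset.univ.filter fun β : D => π β < π α).map (Function.Embedding.subtype _))))
    / (Fintype.card (D ≃ Fin D.card) : ℝ)

open scoped Classical in
/-- The wealth function that maps `B ⊆ D` to the number of minimal positive supports of `q` in `D`
that are contained in `B`. -/
noncomputable def mpsWealth {σ : Schema} {Const Var : Type*} (q : UCQNeg σ Const Var)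
    (D B : Finset (Fact σ Const)) : ℝ :=
  ((B.powerset.filter fun S => IsMinimalPositiveSupport q D S).card : ℝ)

/-- The MPS-Shapley value of the fact `α ∈ D`. -/
noncomputable def mpsShapley {σ : Schema} {Const Var : Type*} (q : UCQNeg σ Const Var)
    (D : Finset (Fact σ Const)) (α : D) : ℝ :=
  shapley D (mpsWealth q D) α

/-- An input of the computational problem: a database, given by a list of its facts in an arbitrary
order and without repetition, together with a fact of the database. -/
structure Input (σ : Schema) (Const : Type) where
  facts : List (Fact σ Const)
  nodup : facts.Nodup
  target : Fact σ Const
  target_mem : target ∈ facts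

open scoped Classical in
/-- The database of an input. -/
noncomputable def Input.db {σ : Schema} {Const : Type} (I : Input σ Const) :
    Finset (Fact σ Const) :=
  I.facts.toFinset

/-- The distinguished fact of an input, as an element of its database. -/
noncomputable def Input.fact {σ : Schema} {Const : Type} (I : Input σ Const) : I.db :=
  ⟨I.target, by simpa [Input.db] using I.target_mem⟩

/-- The alphabet used for inputs and outputs: bits and two delimiters. -/
inductive Sym where
  | bit (b : Bool)
  | endWord
  | endFact
  deriving DecidableEq, Fintype

/-- A bit string, followed by a delimiter. -/
def encodeWord (w : List Bool) : List Sym :=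
  w.map Sym.bit ++ [Sym.endWord]

/-- The name of the relation, the names of the constants from left to right, and a delimiter. -/
def encodeFact {σ : Schema} {Const : Type} (relName : σ.Rel ↪ List Bool)
    (constName : Const ↪ List Bool) (f : Fact σ Const) : List Sym :=
  encodeWord (relName f.rel)
    ++ (List.ofFn fun i => encodeWord (constName (f.args i))).flatten ++ [Sym.endFact]

/-- The distinguished fact, followed by all facts of the database. -/
def encodeInput {σ : Schema} {Const : Type} (relName : σ.Rel ↪ List Bool)
    (constName : Const ↪ List Bool) (I : Input σ Const) : List Sym :=
  encodeFact relName constName I.target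
    ++ (I.facts.map (encodeFact relName constName)).flatten

/-- A rational number in lowest terms: one bit for the sign (`true` if it is negative), then the
absolute value of the numerator and the denominator in binary. -/
def encodeRat (r : ℚ) : List Sym :=
  Sym.bit (decide (r < 0)) :: (encodeWord (Computability.encodeNat r.num.natAbs)
    ++ encodeWord (Computability.encodeNat r.den))

end DB

/-! The wealth function counts the minimal positive supports inside a set, so it is a sum of
unanimity games, one for each minimal support. In an ordering, a minimal support S contributes to
the marginal of α exactly when α is the last element of S, which happens in a fraction 1/|S| of all
orderings. Hence the value is the sum of 1/|S| over the minimal supports S that contain α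
(`card_last_mul`, `shapley_card`). A minimal support consists of the instances of the positive atoms
of one disjunct under one valuation, so |S| is at most a constant K = `q.width` of the query
(`IsMinimalPositiveSupport.card_le`).

Supports are upward closed in D, so a support is minimal as soon as no single element can be
dropped. Therefore the m-tuples y for which {α} ∪ y is a support, but ceases to be one when α or any
component is dropped, enumerate the sets S ∖ {α} with |S| = m + 1, each exactly m! times
(`critical_iff`, `card_critical`). The value becomes (1/K!) · ∑_{m<K} (K!/(m+1)!) · #(critical
m-tuples) (`sum_minimal`). Only polynomially many tuples have to be tested, and the numerator can be
counted in unary.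

For the machine, structured programs over stacks are compiled to `FinTM2` (`Runs.evals`). A fixed
number of pointers walk through copies of the input. The predicates `Dec` and `Cnt`, of what such
programs decide and count in polynomial time, are closed under Boolean operations, sums and loops
over positions. Being a support is within reach: the values of the variables are read off the facts
at the pointers, and negated atoms are tested by a loop of a scratch pointer (`supportedBy_iff`).
The denominator K! is a constant, so the gcd with the numerator depends only on a bounded remainder,
and lowest terms need no more than a finite case distinction (`runs_writeFraction`). -/

namespace DB

/-! ### Structured stack programs and their compilation to machines. -/

/-- Programs over finitely many stacks with alphabet `Sym`. The only control structures are a case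
distinction on the popped symbol, and a loop that goes on as long as the popped symbol satisfies a
given condition. -/
inductive Prog (K : Type) where
  | skip
  | push (k : K) (c : Sym)
  | seq (p q : Prog K)
  | popCase (k : K) (p : Option Sym → Prog K)
  | loop (k : K) (go : Option Sym → Bool) (p : Option Sym → Prog K)

namespace Prog

open Function Turing

section Semantics

variable {K : Type} [DecidableEq K]

/-- `Runs p S S' t`: started on the stacks `S`, the program `p` ends with the stacks `S'` after at
most `t` steps. -/
inductive Runs : Prog K → (K → List Sym) → (K → List Sym) → ℕ → Prop
  | skip (S) : Runs .skip S S 1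
  | push (k c S) : Runs (.push k c) S (update S k (c :: S k)) 1
  | seq {p q S S' S'' t t'} : Runs p S S' t → Runs q S' S'' t' → Runs (.seq p q) S S'' (t + t')
  | popCase {k p S S' t} : Runs (p (S k).head?) (update S k (S k).tail) S' t →
      Runs (.popCase k p) S S' (t + 1)
  | loop_exit {k go p S S' t} : go (S k).head? = false →
      Runs (p (S k).head?) (update S k (S k).tail) S' t → Runs (.loop k go p) S S' (t + 1)
  | loop_next {k go p S S' S'' t t'} : go (S k).head? = true →
      Runs (p (S k).head?) (update S k (S k).tail) S' t →
      Runs (.loop k go p) S' S'' t' → Runs (.loop k go p) S S'' (t + t' + 1)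
  | mono {p S S' t t'} : Runs p S S' t → t ≤ t' → Runs p S S' t'

end Semantics

section Compilation

variable {K : Type}

/-- The labels of the machine code of a program. -/
def Lbl : Prog K → Type
  | .skip => Unit
  | .push _ _ => Unit
  | .seq p q => Lbl p ⊕ Lbl q
  | .popCase _ p => Option (Σ o, Lbl (p o))
  | .loop _ _ p => Option (Σ o, Lbl (p o))

/-- Programs have finitely many labels. -/
@[reducible]
def lblFintype : ∀ p : Prog K, Fintype (Lbl p)
  | .skip => inferInstanceAs (Fintype Unit)
  | .push _ _ => inferInstanceAs (Fintype Unit)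
  | .seq p q =>
    letI := lblFintype p
    letI := lblFintype q
    inferInstanceAs (Fintype (Lbl p ⊕ Lbl q))
  | .popCase _ p =>
    letI := fun o => lblFintype (p o)
    inferInstanceAs (Fintype (Option (Σ o, Lbl (p o))))
  | .loop _ _ p =>
    letI := fun o => lblFintype (p o)
    inferInstanceAs (Fintype (Option (Σ o, Lbl (p o))))

/-- The label at which a program starts. -/
def entry : ∀ p : Prog K, Lbl p
  | .skip => ()
  | .push _ _ => ()
  | .seq p _ => Sum.inl (entry p)
  | .popCase _ _ => (none : Option _)
  | .loop _ _ _ => (none : Option _)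

/-- The machine code of a program, with labels embedded by `e`, that continues at `x`. -/
def code : ∀ (p : Prog K) {Λ : Type} (_ : Lbl p → Λ) (_ : Λ),
    Lbl p → TM2.Stmt (fun _ : K => Sym) Λ (Option Sym)
  | .skip, _, _, x, _ => .goto fun _ => x
  | .push k c, _, _, x, _ => .push k (fun _ => c) (.goto fun _ => x)
  | .seq p q, _, e, _, Sum.inl l => code p (fun l => e (Sum.inl l)) (e (Sum.inr (entry q))) l
  | .seq _ q, _, e, x, Sum.inr l => code q (fun l => e (Sum.inr l)) x l
  | .popCase k p, _, e, _, (none : Option _) =>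
    .pop k (fun _ o => o) (.goto fun v => e (some ⟨v, entry (p v)⟩))
  | .popCase _ p, _, e, x, some ⟨o, l⟩ => code (p o) (fun l => e (some ⟨o, l⟩)) x l
  | .loop k _ p, _, e, _, (none : Option _) =>
    .pop k (fun _ o => o) (.goto fun v => e (some ⟨v, entry (p v)⟩))
  | .loop _ go p, _, e, x, some ⟨o, l⟩ =>
    code (p o) (fun l => e (some ⟨o, l⟩)) (if go o then e (none : Option _) else x) l

variable [DecidableEq K]

/-- A single step, as an evaluation in at most one step. -/
def evalsStep {Λ V : Type} {M : Λ → TM2.Stmt (fun _ : K => Sym) Λ V}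
    {c : TM2.Cfg (fun _ : K => Sym) Λ V} {c'} (h : TM2.step M c = some c') :
    StateTransition.EvalsToInTime (TM2.step M) c (some c') 1 :=
  ⟨⟨1, by simpa [flip] using h⟩, le_rfl⟩

/-- Induction on the run, with `e` and `x` general so that a subprogram can sit inside any machine
that agrees with its code on its labels. The body of a `popCase` or `loop` is compiled once per
popped value, so the label remembers that value and `go` is resolved statically. The register is
read only right after a pop, so its initial and final contents do not matter. -/
theorem Runs.evals {p : Prog K} {S S' : K → List Sym} {t : ℕ} (h : Runs p S S' t) :
    ∀ {Λ : Type} (e : Lbl p → Λ) (x : Λ) (M : Λ → TM2.Stmt (fun _ : K => Sym) Λ (Option Sym)),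
      (∀ l, M (e l) = code p e x l) → ∀ v, ∃ v',
        Nonempty (StateTransition.EvalsToInTime (TM2.step M) ⟨some (e (entry p)), v, S⟩
          (some ⟨some x, v', S'⟩) t) := by
  induction h with
  | skip S =>
    intro Λ e x M hM v
    exact ⟨v, ⟨evalsStep (congrArg (fun q => some (TM2.stepAux q v S)) (hM _))⟩⟩
  | push k c S =>
    intro Λ e x M hM v
    exact ⟨v, ⟨evalsStep (congrArg (fun q => some (TM2.stepAux q v S)) (hM _))⟩⟩
  | @seq p q S S' S'' t t' _ _ ih₁ ih₂ =>
    intro Λ e x M hM v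
    obtain ⟨v₁, ⟨h₁⟩⟩ := ih₁ (fun l => e (Sum.inl l)) (e (Sum.inr (entry q))) M
      (fun l => hM (Sum.inl l)) v
    obtain ⟨v₂, ⟨h₂⟩⟩ := ih₂ (fun l => e (Sum.inr l)) x M (fun l => hM (Sum.inr l)) v₁
    exact ⟨v₂, ⟨by rw [add_comm]; exact h₁.trans _ _ _ _ _ _ h₂⟩⟩
  | @popCase k p S S' t _ ih =>
    intro Λ e x M hM v
    obtain ⟨v₁, ⟨h₁⟩⟩ := ih (fun l => e (some ⟨(S k).head?, l⟩)) x M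
      (fun l => hM (some ⟨(S k).head?, l⟩)) (S k).head?
    have h₀ : StateTransition.EvalsToInTime (TM2.step M) ⟨some (e (entry (.popCase k p))), v, S⟩
        (some ⟨some (e (some ⟨(S k).head?, entry (p (S k).head?)⟩)), (S k).head?,
          update S k (S k).tail⟩) 1 :=
      evalsStep (congrArg (fun q => some (TM2.stepAux q v S)) (hM (none : Option _)))
    exact ⟨v₁, ⟨h₀.trans _ _ _ _ _ _ h₁⟩⟩
  | @loop_exit k go p S S' t hk _ ih =>
    intro Λ e x M hM v
    obtain ⟨v₁, ⟨h₁⟩⟩ := ih (fun l => e (some ⟨(S k).head?, l⟩)) x M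
      (fun l => (hM (some ⟨(S k).head?, l⟩)).trans (by simp only [code, hk]; rfl)) (S k).head?
    have h₀ : StateTransition.EvalsToInTime (TM2.step M) ⟨some (e (entry (.loop k go p))), v, S⟩
        (some ⟨some (e (some ⟨(S k).head?, entry (p (S k).head?)⟩)), (S k).head?,
          update S k (S k).tail⟩) 1 :=
      evalsStep (congrArg (fun q => some (TM2.stepAux q v S)) (hM (none : Option _)))
    exact ⟨v₁, ⟨h₀.trans _ _ _ _ _ _ h₁⟩⟩
  | @loop_next k go p S S' S'' t t' hk _ _ ih₁ ih₂ =>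
    intro Λ e x M hM v
    obtain ⟨v₁, ⟨h₁⟩⟩ := ih₁ (fun l => e (some ⟨(S k).head?, l⟩)) (e (none : Option _)) M
      (fun l => (hM (some ⟨(S k).head?, l⟩)).trans (by simp only [code, hk]; rfl)) (S k).head?
    obtain ⟨v₂, ⟨h₂⟩⟩ := ih₂ e x M hM v₁
    have h₀ : StateTransition.EvalsToInTime (TM2.step M) ⟨some (e (entry (.loop k go p))), v, S⟩
        (some ⟨some (e (some ⟨(S k).head?, entry (p (S k).head?)⟩)), (S k).head?,
          update S k (S k).tail⟩) 1 :=
      evalsStep (congrArg (fun q => some (TM2.stepAux q v S)) (hM (none : Option _)))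
    refine ⟨v₂, ⟨?_⟩⟩
    have := (h₀.trans _ _ _ _ _ _ h₁).trans _ _ _ _ _ _ h₂
    rwa [show t' + (t + 1) = t + t' + 1 by ring] at this
  | @mono p S S' t t' _ htt ih =>
    intro Λ e x M hM v
    obtain ⟨v₁, ⟨h₁⟩⟩ := ih e x M hM v
    exact ⟨v₁, ⟨h₁.toEvalsTo, h₁.steps_le_m.trans htt⟩⟩

/-- The machine that runs `p`, with input stack `i` and output stack `o`. -/
def machine [Fintype K] (p : Prog K) (i o : K) : FinTM2 where
  K := K
  k₀ := i
  k₁ := o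
  Γ _ := Sym
  Λ := Option (Lbl p)
  main := some (entry p)
  ΛFin := letI := lblFintype p; inferInstance
  σ := Option Sym
  initialState := none
  Γk₀Fin := inferInstanceAs (Fintype Sym)
  -- The label `none` is the exit. It resets the register, because `haltList` demands the initial
  -- state.
  m l := l.elim (.load (fun _ => none) .halt) (code p some none)

theorem machine_outputs [Fintype K] (p : Prog K) (i o : K) {l l' : List Sym} {t : ℕ}
    (h : Runs p (update (fun _ => []) i l) (update (fun _ => []) o l') t) :
    Nonempty (TM2OutputsInTime (machine p i o) l (some l') (t + 1)) := by
  obtain ⟨v, ⟨hv⟩⟩ := h.evals (Λ := Option (Lbl p)) some none (machine p i o).m (fun l => rfl) none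
  have h₁ : StateTransition.EvalsToInTime (TM2.step (Λ := Option (Lbl p)) (machine p i o).m)
      ⟨some none, v, update (fun _ => []) o l'⟩
      (some ⟨none, none, update (fun _ => []) o l'⟩) 1 := evalsStep rfl
  have h₂ := hv.trans _ _ _ _ _ _ h₁
  have e₁ : initList (machine p i o) l
      = ⟨some (some (entry p)), none, update (fun _ => []) i l⟩ := by
    unfold initList
    refine congrArg (TM2.Cfg.mk (some (some (entry p))) none) (funext fun (k : K) => ?_)
    by_cases hk : k = i
    · obtain rfl := hk.symm
      exact (dif_pos rfl).trans (update_self (β := fun _ => List Sym) _ l _).symm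
    · exact (dif_neg hk).trans
        (update_of_ne (β := fun _ => List Sym) (f := fun _ => []) hk l).symm
  have e₂ : haltList (machine p i o) l' = ⟨none, none, update (fun _ => []) o l'⟩ := by
    unfold haltList
    refine congrArg (TM2.Cfg.mk none none) (funext fun (k : K) => ?_)
    by_cases hk : k = o
    · obtain rfl := hk.symm
      exact (dif_pos rfl).trans (update_self (β := fun _ => List Sym) _ l' _).symm
    · exact (dif_neg hk).trans
        (update_of_ne (β := fun _ => List Sym) (f := fun _ => []) hk l').symm
  have e₃ : StateTransition.EvalsToInTime (machine p i o).step (initList (machine p i o) l)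
      (some (haltList (machine p i o) l')) (1 + t) := by
    rw [e₁, e₂]
    exact h₂
  rw [add_comm]
  exact ⟨e₃⟩

/-- A function that is computed by a program in polynomial time is computable in polynomial
time. -/
theorem computable [Fintype K] (p : Prog K) (i o : K) {α β : Type} (ea : α → List Sym)
    (eb : β → List Sym) (f : α → β) (t : Polynomial ℕ)
    (h : ∀ a, Runs p (update (fun _ => []) i (ea a)) (update (fun _ => []) o (eb (f a)))
      (t.eval (ea a).length)) :
    Nonempty (TM2ComputableInPolyTime ea eb f) := by
  refine ⟨{ tm := machine p i o, inputAlphabet := Equiv.refl Sym, outputAlphabet := Equiv.refl Sym,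
            time := t + 1, outputsFun := fun a => ?_ }⟩
  have e (l : List Sym) : List.map (Equiv.refl Sym).invFun l = l := List.map_id l
  -- Arbitrary `l` and `l'` with equations absorb the translation of alphabets, which is the
  -- identity by `e`.
  have h₁ : ∀ l l' : List Sym, l = ea a → l' = eb (f a) →
      Nonempty (TM2OutputsInTime (machine p i o) l (some l') ((t + 1).eval (ea a).length)) := by
    rintro _ _ rfl rfl
    rw [Polynomial.eval_add, Polynomial.eval_one]
    exact machine_outputs p i o (h a)
  exact (h₁ _ _ (e (ea a)) (e (eb (f a)))).some

end Compilation

end Prog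

end DB

/-! ### Elementary stack programs and the layout of the stacks. -/

namespace DB

namespace Prog

open Function

section General

variable {K : Type} [DecidableEq K]

theorem Runs.of_eq {p : Prog K} {S S' S'' : K → List Sym} {t t' : ℕ} (h : Runs p S S' t)
    (hS : S' = S'') (ht : t ≤ t') : Runs p S S'' t' :=
  hS ▸ h.mono ht

theorem Runs.start {p : Prog K} {S T S' : K → List Sym} {t : ℕ} (h : Runs p T S' t)
    (hS : S = T) : Runs p S S' t :=
  hS ▸ h

theorem Runs.push_eq {k : K} {c : Sym} {S S' : K → List Sym} (h : update S k (c :: S k) = S') :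
    Runs (.push k c) S S' 1 :=
  h ▸ Runs.push k c S

theorem Runs.skip_eq {S S' : K → List Sym} (h : S = S') : Runs .skip S S' 1 :=
  h ▸ Runs.skip S

/-- Pop the stack `k` until it is empty, and run `p c` for every popped symbol `c`. -/
def drain (k : K) (p : Sym → Prog K) : Prog K :=
  .loop k Option.isSome fun o => o.elim .skip p

theorem drain_nil {k : K} {p : Sym → Prog K} {S : K → List Sym} (h : S k = []) :
    Runs (drain k p) S S 2 := by
  refine Runs.loop_exit (t := 1) (by simp [h]) ?_
  have : update S k (S k).tail = S := by rw [h, List.tail_nil, ← h, update_eq_self]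
  rw [this, h]
  exact Runs.skip S

theorem drain_cons {k : K} {p : Sym → Prog K} {S S' S'' : K → List Sym} {c : Sym} {l : List Sym}
    {t t' : ℕ} (h : S k = c :: l) (h₁ : Runs (p c) (update S k l) S' t)
    (h₂ : Runs (drain k p) S' S'' t') : Runs (drain k p) S S'' (t + t' + 1) := by
  refine Runs.loop_next (by simp [h]) ?_ h₂
  rw [h]
  exact h₁

/-- Run the programs of a list one after the other. -/
def seqs : List (Prog K) → Prog K
  | [] => .skip
  | p :: ps => .seq p (seqs ps)

/-- Move the contents of the stack `k` to the stack `k'`, which reverses their order. -/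
def move (k k' : K) : Prog K :=
  drain k fun c => .push k' c

theorem runs_move {k k' : K} (hk : k ≠ k') : ∀ (l : List Sym) (S : K → List Sym), S k = l →
    Runs (move k k') S (update (update S k []) k' (l.reverse ++ S k')) (2 * l.length + 2)
  | [], S, h => by
    refine (drain_nil h).of_eq ?_ (by simp)
    have h' : update S k [] = S := by rw [← h, update_eq_self]
    simp [h']
  | c :: l, S, h => by
    refine (drain_cons h (Runs.push _ _ _)
      (runs_move hk l _ (by simp [update_of_ne hk]))).of_eq ?_ (by simp; omega)
    funext j
    by_cases h₁ : j = k' <;> by_cases h₂ : j = k <;> simp_all [update_apply]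

/-- Empty the stack `k`. -/
def clear (k : K) : Prog K :=
  drain k fun _ => .skip

theorem runs_clear {k : K} : ∀ (l : List Sym) (S : K → List Sym), S k = l →
    Runs (clear k) S (update S k []) (2 * l.length + 2)
  | [], S, h => (drain_nil h).of_eq (by rw [← h, update_eq_self]) (by simp)
  | c :: l, S, h =>
    (drain_cons h (Runs.skip _) (runs_clear l _ (by simp))).of_eq (by simp) (by simp; omega)

/-- Push the symbols of `w` from left to right on the stack `k`. -/
def pushes (k : K) (w : List Sym) : Prog K :=
  seqs (w.map (.push k))

theorem runs_pushes {k : K} : ∀ (w : List Sym) (S : K → List Sym),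
    Runs (pushes k w) S (update S k (w.reverse ++ S k)) (w.length + 1)
  | [], S => (Runs.skip S).of_eq (by simp) (by simp)
  | c :: w, S => (Runs.seq (Runs.push k c S) (runs_pushes w _)).of_eq (by simp) (by simp; omega)

end General

end Prog

/-- The stacks of the machine: for every pointer, what is to the left and to the right of the
pointer in a copy of the input; three auxiliary stacks, a stack of truth values, a unary counter,
and the output. -/
inductive Stk (ι : Type) where
  | left (i : ι)
  | right (i : ι)
  | aux
  | fst
  | snd
  | truth
  | count
  | out
  deriving DecidableEq, Fintype

namespace Stk

variable {ι : Type}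

/-- The contents of all stacks. -/
def all (l r : ι → List Sym) (x u v b q o : List Sym) : Stk ι → List Sym
  | left i => l i
  | right i => r i
  | aux => x
  | fst => u
  | snd => v
  | truth => b
  | count => q
  | out => o

section

variable (l r : ι → List Sym) (x u v b q o w : List Sym)

@[simp] theorem all_left (i : ι) : all l r x u v b q o (left i) = l i := rfl
@[simp] theorem all_right (i : ι) : all l r x u v b q o (right i) = r i := rfl
@[simp] theorem all_aux : all l r x u v b q o aux = x := rfl
@[simp] theorem all_fst : all l r x u v b q o fst = u := rfl
@[simp] theorem all_snd : all l r x u v b q o snd = v := rfl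
@[simp] theorem all_truth : all l r x u v b q o truth = b := rfl
@[simp] theorem all_count : all l r x u v b q o count = q := rfl
@[simp] theorem all_out : all l r x u v b q o out = o := rfl

open Function

variable [DecidableEq ι]

@[simp] theorem update_left (i : ι) : update (all l r x u v b q o) (left i) w
    = all (update l i w) r x u v b q o := by
  funext k
  cases k <;> simp [update_apply, all]

@[simp] theorem update_right (i : ι) : update (all l r x u v b q o) (right i) w
    = all l (update r i w) x u v b q o := by
  funext k
  cases k <;> simp [update_apply, all]

@[simp] theorem update_aux : update (all l r x u v b q o) aux w = all l r w u v b q o := by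
  funext k
  cases k <;> simp [all]

@[simp] theorem update_fst : update (all l r x u v b q o) fst w = all l r x w v b q o := by
  funext k
  cases k <;> simp [all]

@[simp] theorem update_snd : update (all l r x u v b q o) snd w = all l r x u w b q o := by
  funext k
  cases k <;> simp [all]

@[simp] theorem update_truth : update (all l r x u v b q o) truth w
    = all l r x u v w q o := by
  funext k
  cases k <;> simp [all]

@[simp] theorem update_count : update (all l r x u v b q o) count w
    = all l r x u v b w o := by
  funext k
  cases k <;> simp [all]

@[simp] theorem update_out : update (all l r x u v b q o) out w
    = all l r x u v b q w := by
  funext k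
  cases k <;> simp [all]

end

end Stk

/-! ### Reading and comparing delimited words. -/

/-- The first piece of a string: everything up to and including the first delimiter. -/
def piece : List Sym → List Sym
  | [] => []
  | .bit b :: l => .bit b :: piece l
  | c :: _ => [c]

/-- What follows after the first piece of a string. -/
def afterPiece : List Sym → List Sym
  | [] => []
  | .bit _ :: l => afterPiece l
  | _ :: l => l

theorem piece_append_afterPiece : ∀ l, piece l ++ afterPiece l = l
  | [] => rfl
  | .bit _ :: l => by simp [piece, afterPiece, piece_append_afterPiece l]
  | .endWord :: _ => rfl
  | .endFact :: _ => rfl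

theorem length_piece_le (l : List Sym) : (piece l).length ≤ l.length := by
  conv_rhs => rw [← piece_append_afterPiece l]
  simp

theorem length_afterPiece_le (l : List Sym) : (afterPiece l).length ≤ l.length := by
  conv_rhs => rw [← piece_append_afterPiece l]
  simp

/-- The piece with number `a` of a string. -/
def pieceAt (a : ℕ) (l : List Sym) : List Sym :=
  piece (afterPiece^[a] l)

namespace Prog

open Function Stk

variable {ι : Type} [DecidableEq ι]

/-- The symbol is a bit. -/
def isBit : Option Sym → Bool
  | some (.bit _) => true
  | _ => false

/-- Move the pointer `i` to the right over one piece, which is stored in `aux` and treated with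
`p` symbol by symbol. -/
def scan (i : ι) (p : Sym → Prog (Stk ι)) : Prog (Stk ι) :=
  .loop (right i) isBit fun o => o.elim .skip fun c => .seq (.push aux c) (p c)

/-- A loop also runs its body on the symbol at which it stops, so the closing delimiter reaches
`aux` together with the bits. -/
theorem runs_scan_skip (i : ι) (l : ι → List Sym) (u v b q o : List Sym) :
    ∀ (w : List Sym) (r : ι → List Sym) (x : List Sym), r i = w →
      Runs (scan i fun _ => .skip) (all l r x u v b q o)
        (all l (update r i (afterPiece w)) ((piece w).reverse ++ x) u v b q o)
        (3 * w.length + 2)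
  | [], r, x, h => by
    refine (Runs.loop_exit (t := 1) (by simp [h, isBit]) ?_).of_eq rfl (by simp)
    simpa [h, piece, afterPiece] using Runs.skip _
  | .bit c :: w, r, x, h => by
    refine (Runs.loop_next (t := 2) (by simp [h, isBit]) ?_
      (runs_scan_skip i l u v b q o w (update r i w) (.bit c :: x) (by simp))).of_eq ?_ ?_
    · simp only [all_right, h, List.head?_cons, List.tail_cons, update_right, Option.elim_some]
      exact Runs.seq (Runs.push _ _ _) (Runs.skip_eq (by simp))
    · simp [piece, afterPiece]
    · simp; omega
  | .endWord :: w, r, x, h => by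
    refine (Runs.loop_exit (t := 2) (by simp [h, isBit]) ?_).of_eq rfl (by simp; omega)
    simp only [all_right, h, List.head?_cons, List.tail_cons, update_right, Option.elim_some]
    exact Runs.seq (Runs.push _ _ _) (Runs.skip_eq (by simp [piece, afterPiece]))
  | .endFact :: w, r, x, h => by
    refine (Runs.loop_exit (t := 2) (by simp [h, isBit]) ?_).of_eq rfl (by simp; omega)
    simp only [all_right, h, List.head?_cons, List.tail_cons, update_right, Option.elim_some]
    exact Runs.seq (Runs.push _ _ _) (Runs.skip_eq (by simp [piece, afterPiece]))

/-- The two auxiliary stacks that hold words to be compared. -/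
def wordStk : Bool → Stk ι
  | true => fst
  | false => snd

/-- The copy is reversed. This is harmless, since all words to be compared are loaded in reverse. -/
theorem runs_scan_copy (i : ι) (l : ι → List Sym) (b q o : List Sym) (d : Bool) :
    ∀ (w : List Sym) (r : ι → List Sym) (x u v : List Sym), r i = w →
      Runs (scan i fun c => .push (wordStk d) c) (all l r x u v b q o)
        (all l (update r i (afterPiece w)) ((piece w).reverse ++ x)
          (bif d then (piece w).reverse ++ u else u) (bif d then v else (piece w).reverse ++ v)
          b q o)
        (3 * w.length + 2)
  | [], r, x, u, v, h => by
    refine (Runs.loop_exit (t := 1) (by simp [h, isBit]) ?_).of_eq rfl (by simp)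
    simpa [h, piece, afterPiece] using Runs.skip _
  | .bit c :: w, r, x, u, v, h => by
    refine (Runs.loop_next (t := 2) (by simp [h, isBit]) ?_
      (runs_scan_copy i l b q o d w (update r i w) (.bit c :: x)
        (bif d then .bit c :: u else u) (bif d then v else .bit c :: v) (by simp))).of_eq ?_ ?_
    · simp only [all_right, h, List.head?_cons, List.tail_cons, update_right, Option.elim_some]
      exact Runs.seq (Runs.push _ _ _) (Runs.push_eq (by cases d <;> simp [wordStk]))
    · cases d <;> simp [piece, afterPiece]
    · simp; omega
  | .endWord :: w, r, x, u, v, h => by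
    refine (Runs.loop_exit (t := 2) (by simp [h, isBit]) ?_).of_eq rfl (by simp; omega)
    simp only [all_right, h, List.head?_cons, List.tail_cons, update_right, Option.elim_some]
    exact Runs.seq (Runs.push _ _ _)
      (Runs.push_eq (by cases d <;> simp [piece, afterPiece, wordStk]))
  | .endFact :: w, r, x, u, v, h => by
    refine (Runs.loop_exit (t := 2) (by simp [h, isBit]) ?_).of_eq rfl (by simp; omega)
    simp only [all_right, h, List.head?_cons, List.tail_cons, update_right, Option.elim_some]
    exact Runs.seq (Runs.push _ _ _)
      (Runs.push_eq (by cases d <;> simp [piece, afterPiece, wordStk]))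

/-- Move the pointer `i` to the right over `a` pieces, and copy the next piece. -/
def fetchAux (i : ι) (d : Bool) : ℕ → Prog (Stk ι)
  | 0 => scan i fun c => .push (wordStk d) c
  | a + 1 => .seq (scan i fun _ => .skip) (fetchAux i d a)

/-- Where the scanned part `w₁` ends is irrelevant: it lies reversed on `aux`, so a single `move`
will put it back. -/
theorem runs_fetchAux (i : ι) (l : ι → List Sym) (u v b q o : List Sym) (d : Bool) :
    ∀ (a : ℕ) (w : List Sym) (r : ι → List Sym) (x : List Sym), r i = w →
      ∃ w₁ w₂, w = w₁ ++ w₂ ∧ Runs (fetchAux i d a) (all l r x u v b q o)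
        (all l (update r i w₂) (w₁.reverse ++ x)
          (bif d then (pieceAt a w).reverse ++ u else u)
          (bif d then v else (pieceAt a w).reverse ++ v) b q o)
        ((a + 1) * (3 * w.length + 2))
  | 0, w, r, x, h => by
    refine ⟨piece w, afterPiece w, (piece_append_afterPiece w).symm, ?_⟩
    exact (runs_scan_copy i l b q o d w r x u v h).of_eq rfl (by simp)
  | a + 1, w, r, x, h => by
    obtain ⟨w₁, w₂, h₁, h₂⟩ := runs_fetchAux i l u v b q o d a (afterPiece w)
      (update r i (afterPiece w)) ((piece w).reverse ++ x) (by simp)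
    refine ⟨piece w ++ w₁, w₂, by rw [List.append_assoc, ← h₁, piece_append_afterPiece], ?_⟩
    refine (Runs.seq (runs_scan_skip i l u v b q o w r x h) h₂).of_eq (by simp [pieceAt]) ?_
    have := length_afterPiece_le w
    have : (a + 1) * (3 * (afterPiece w).length + 2) ≤ (a + 1) * (3 * w.length + 2) := by gcongr
    linarith

/-- Push the piece with number `a` after the pointer `i` on one of the auxiliary stacks. -/
def fetch (i : ι) (d : Bool) (a : ℕ) : Prog (Stk ι) :=
  .seq (fetchAux i d a) (move aux (right i))

theorem runs_fetch (i : ι) (l r : ι → List Sym) (u v b q o : List Sym) (d : Bool) (a : ℕ) :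
    Runs (fetch i d a) (all l r [] u v b q o)
      (all l r [] (bif d then (pieceAt a (r i)).reverse ++ u else u)
        (bif d then v else (pieceAt a (r i)).reverse ++ v) b q o)
      ((a + 2) * (3 * (r i).length + 2)) := by
  obtain ⟨w₁, w₂, h₁, h₂⟩ := runs_fetchAux i l u v b q o d a (r i) r [] rfl
  refine (Runs.seq h₂ (runs_move (by simp) _ _ rfl)).of_eq ?_ ?_
  · simp [← h₁]
  · have : w₁.length ≤ (r i).length := by rw [h₁]; simp
    simp only [all_aux, List.append_nil, List.length_reverse]
    linarith

/-- Replace the topmost truth value by `false`. -/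
def setFalse : Prog (Stk ι) :=
  .popCase truth fun _ => .push truth (.bit false)

/-- Remove a prefix of `snd` while emptying `fst`, and set the topmost truth value to `false` at
the first difference. -/
def matchPrefix : Prog (Stk ι) :=
  drain fst fun c => .popCase snd fun o => if o = some c then .skip else setFalse

/-- The invariant is the conjunction of the flag with what is still to be compared. At a difference
the flag becomes `false` for good and symbols are merely discarded; at the end, equality means that
the flag survived and nothing is left in `snd`. -/
theorem runs_matchPrefix (l r : ι → List Sym) (b q o : List Sym) :
    ∀ (u v : List Sym) (e : Bool), ∃ v' e', v'.length ≤ v.length ∧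
      (e' && decide (v' = [])) = (e && decide (u = v)) ∧
      Runs matchPrefix (all l r [] u v (.bit e :: b) q o)
        (all l r [] [] v' (.bit e' :: b) q o) (4 * u.length + 2)
  | [], v, e => ⟨v, e, le_rfl, by simp [eq_comm], drain_nil rfl⟩
  | c :: u, v, e => by
    by_cases h : v.head? = some c
    · obtain ⟨v, rfl⟩ : ∃ v', v = c :: v' := by
        cases v <;> simp_all
      obtain ⟨v', e', h₁, h₂, h₃⟩ := runs_matchPrefix l r b q o u v e
      refine ⟨v', e', by simp; omega, by simpa using h₂, ?_⟩
      unfold matchPrefix at h₃ ⊢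
      refine Runs.mono (drain_cons (c := c) (l := u) rfl (Runs.popCase (t := 1) ?_) h₃) ?_
      swap
      · simp
        omega
      simp only [update_fst, all_snd, List.head?_cons, if_true]
      exact Runs.skip_eq (by simp)
    · obtain ⟨v', e', h₁, h₂, h₃⟩ := runs_matchPrefix l r b q o u v.tail false
      refine ⟨v', e', by simp at h₁; omega, ?_, ?_⟩
      · rw [h₂, Bool.false_and, eq_comm, Bool.and_eq_false_iff]
        right
        rw [decide_eq_false_iff_not]
        rintro rfl
        simp at h
      · unfold matchPrefix at h₃ ⊢
        refine Runs.mono (drain_cons (c := c) (l := u) rfl (Runs.popCase (t := 2) ?_) h₃) ?_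
        swap
        · simp
          omega
        simp only [update_fst, all_snd, h, if_false]
        exact Runs.popCase (Runs.push_eq (by simp))

/-- Compare and empty the two auxiliary stacks, and push the truth value of their equality. -/
def compareWords : Prog (Stk ι) :=
  .seq (.push truth (.bit true)) (.seq matchPrefix
    (.popCase snd fun o => if o = none then .skip else .seq (clear snd) setFalse))

theorem runs_compareWords (l r : ι → List Sym) (b q o u v : List Sym) :
    Runs compareWords (all l r [] u v b q o)
      (all l r [] [] [] (.bit (decide (u = v)) :: b) q o)
      (4 * u.length + 2 * v.length + 8) := by
  obtain ⟨v', e', h₁, h₂, h₃⟩ := runs_matchPrefix l r b q o u v true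
  rw [Bool.true_and] at h₂
  rw [← h₂]
  refine (Runs.seq (Runs.push _ _ _) ((Runs.seq h₃
    (Runs.popCase (t := 2 * v.length + 4) ?_)).start (by simp))).mono (by omega)
  cases v' with
  | nil =>
    simp only [all_snd, List.head?_nil, if_true, update_snd, List.tail_nil, decide_true,
      Bool.and_true]
    exact (Runs.skip _).mono (by omega)
  | cons c v' =>
    simp only [all_snd, List.head?_cons, reduceCtorEq, if_false, update_snd, List.tail_cons,
      decide_false, Bool.and_false]
    refine (Runs.seq (runs_clear v' _ rfl) (Runs.popCase (Runs.push_eq ?_))).mono ?_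
    · simp
    · simp at h₁
      omega

end Prog

end DB

/-! ### Deciding predicates and counting with pointers into the input. -/

namespace DB

namespace Prog

open Function Stk

variable {ι : Type} [DecidableEq ι]

/-- The stacks when the pointers are at the positions `x` of the input `s`. -/
def cfg (s : List Sym) (x : ι → ℕ) (b q : List Sym) : Stk ι → List Sym :=
  all (fun i => (s.take (x i)).reverse) (fun i => s.drop (x i)) [] [] [] b q []

open scoped Classical in
/-- Some program finds out in polynomial time whether `P s x` holds, for all inputs `s` and all
positions `x` of the pointers that satisfy `C`. -/
def Dec (C : (ι → ℕ) → Prop) (P : List Sym → (ι → ℕ) → Prop) : Prop :=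
  ∃ (p : Prog (Stk ι)) (t : Polynomial ℕ), ∀ s x b q, C x →
    Runs p (cfg s x b q) (cfg s x (.bit (decide (P s x)) :: b) q) (t.eval s.length)

/-- Some program adds the number `N s x` to the unary counter in polynomial time, for all inputs
`s` and all positions `x` of the pointers that satisfy `C`. -/
def Cnt (C : (ι → ℕ) → Prop) (N : List Sym → (ι → ℕ) → ℕ) : Prop :=
  ∃ (p : Prog (Stk ι)) (t : Polynomial ℕ), ∀ s x b q, C x →
    Runs p (cfg s x b q) (cfg s x b (List.replicate (N s x) (.bit true) ++ q)) (t.eval s.length)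

variable {C C' : (ι → ℕ) → Prop} {P P' : List Sym → (ι → ℕ) → Prop}
  {N N' : List Sym → (ι → ℕ) → ℕ}

section Decision

theorem Dec.congr (h : Dec C P) (hP : ∀ s x, C x → (P s x ↔ P' s x)) : Dec C P' := by
  obtain ⟨p, t, h⟩ := h
  refine ⟨p, t, fun s x b q hx => ?_⟩
  rw [← decide_eq_decide.2 (hP s x hx)]
  exact h s x b q hx

theorem Dec.not (h : Dec C P) : Dec C fun s x => ¬ P s x := by
  obtain ⟨p, t, h⟩ := h
  refine ⟨.seq p (.popCase truth fun o => .push truth (.bit (o = some (.bit false)))), t + 2,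
    fun s x b q hx => (Runs.seq (h s x b q hx) (Runs.popCase (Runs.push_eq ?_))).of_eq rfl ?_⟩
  · by_cases hP : P s x <;> simp [cfg, hP]
  · simp

theorem Dec.and (h : Dec C P) (h' : Dec C P') : Dec C fun s x => P s x ∧ P' s x := by
  obtain ⟨p, t, h⟩ := h
  obtain ⟨p', t', h'⟩ := h'
  refine ⟨.seq p (.seq p' (.popCase truth fun o => .popCase truth fun o' =>
      .push truth (.bit (o = some (.bit true) ∧ o' = some (.bit true))))), t + t' + 3,
    fun s x b q hx => (Runs.seq (h s x b q hx) (Runs.seq (h' s x _ q hx)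
      (Runs.popCase (Runs.popCase (Runs.push_eq ?_))))).of_eq rfl ?_⟩
  · by_cases hP : P s x <;> by_cases hP' : P' s x <;> simp [cfg, hP, hP']
  · simp; ring_nf; rfl

theorem Dec.or (h : Dec C P) (h' : Dec C P') : Dec C fun s x => P s x ∨ P' s x :=
  (h.not.and h'.not).not.congr fun s x _ => by tauto

theorem Dec.const (a : Prop) : Dec C fun _ _ => a := by
  classical
  exact ⟨.push truth (.bit (decide a)), 1, fun s x b q _ =>
    (Runs.push_eq (by simp [cfg])).of_eq rfl (by simp)⟩

/-- The index set does not depend on the input, so the program may contain a separate piece for each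
index. Quantifiers over the input go through `Dec.exists_position` instead. -/
theorem Dec.exists_mem {η : Type*} {F : Set η} (hF : F.Finite)
    {P : η → List Sym → (ι → ℕ) → Prop} (h : ∀ a ∈ F, Dec C (P a)) :
    Dec C fun s x => ∃ a ∈ F, P a s x := by
  induction F, hF using Set.Finite.induction_on with
  | empty => exact (Dec.const False).congr fun s x _ => by simp
  | @insert a F _ _ ih =>
    exact ((h a (by simp)).or (ih fun b hb => h b (by simp [hb]))).congr
      fun s x _ => by simp

theorem Dec.exists {η : Type*} [Finite η] {P : η → List Sym → (ι → ℕ) → Prop}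
    (h : ∀ a, Dec C (P a)) : Dec C fun s x => ∃ a, P a s x :=
  (Dec.exists_mem (F := Set.univ) Set.finite_univ fun a _ => h a).congr fun s x _ => by simp

theorem Dec.forall_mem {η : Type*} {F : Set η} (hF : F.Finite)
    {P : η → List Sym → (ι → ℕ) → Prop} (h : ∀ a ∈ F, Dec C (P a)) :
    Dec C fun s x => ∀ a ∈ F, P a s x :=
  (Dec.exists_mem hF fun a ha => (h a ha).not).not.congr fun s x _ => by simp

theorem Dec.forall {η : Type*} [Finite η] {P : η → List Sym → (ι → ℕ) → Prop}
    (h : ∀ a, Dec C (P a)) : Dec C fun s x => ∀ a, P a s x :=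
  (Dec.exists fun a => (h a).not).not.congr fun s x _ => by simp

/-- The symbol before the pointer `i` can be tested. -/
theorem dec_previous (i : ι) (f : Option Sym → Bool) :
    Dec C fun s x => f (s.take (x i)).getLast? = true := by
  have key (l r : ι → List Sym) (b q : List Sym) : Runs (.popCase (left i) fun o =>
      .seq (o.elim .skip fun c => .push (left i) c) (.push truth (.bit (f o))))
      (all l r [] [] [] b q []) (all l r [] [] [] (.bit (f (l i).head?) :: b) q []) 3 := by
    refine Runs.popCase (t := 2) (Runs.seq (S' := all l r [] [] [] b q []) ?_
      (Runs.push_eq (by simp)))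
    simp only [all_left, update_left]
    cases h : l i with
    | nil =>
      have h' : update l i [] = l := by rw [← h, update_eq_self]
      exact Runs.skip_eq (by simp [h'])
    | cons c w =>
      have h' : update l i (c :: w) = l := by rw [← h, update_eq_self]
      exact Runs.push_eq (by simp [h'])
  refine ⟨_, 3, fun s x b q _ => (key _ _ b q).of_eq ?_ (by simp)⟩
  simp [cfg]

theorem length_pieceAt_le (a : ℕ) (l : List Sym) : (pieceAt a l).length ≤ l.length := by
  refine (length_piece_le _).trans ?_
  induction a with
  | zero => rfl
  | succ a ih =>
    rw [iterate_succ_apply']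
    exact (length_afterPiece_le _).trans ih

/-- A string that is given explicitly, or as the piece with number `a` after the pointer `i`. -/
inductive Ref (ι : Type) where
  | word (w : List Sym)
  | piece (i : ι) (a : ℕ)

/-- The string that is referred to. -/
def Ref.val (s : List Sym) (x : ι → ℕ) : Ref ι → List Sym
  | .word w => w
  | .piece i a => pieceAt a (s.drop (x i))

/-- Push a string on one of the auxiliary stacks. -/
def Ref.load (d : Bool) : Ref ι → Prog (Stk ι)
  | .word w => pushes (wordStk d) w
  | .piece i a => fetch i d a

/-- The constant `n` accounts for explicit words; the length bound makes the subsequent comparison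
polynomial. -/
theorem Ref.runs_load (e : Ref ι) (d : Bool) : ∃ (t : Polynomial ℕ) (n : ℕ), 
    (∀ s x, (e.val s x).length ≤ s.length + n) ∧ ∀ (s : List Sym) (x : ι → ℕ) (u v b q : List Sym),
    Runs (e.load d)
      (all (fun i => (s.take (x i)).reverse) (fun i => s.drop (x i)) [] u v b q [])
      (all (fun i => (s.take (x i)).reverse) (fun i => s.drop (x i)) []
        (bif d then (e.val s x).reverse ++ u else u) (bif d then v else (e.val s x).reverse ++ v)
        b q []) (t.eval s.length) := by
  cases e with
  | word w =>
    refine ⟨(w.length : Polynomial ℕ) + 1, w.length, fun s x => by simp [val],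
      fun s x u v b q => (runs_pushes w _).of_eq ?_ (by simp)⟩
    cases d <;> simp [wordStk, val]
  | piece i a =>
    refine ⟨((a + 2 : ℕ) : Polynomial ℕ) * (3 * Polynomial.X + 2), 0, fun s x => ?_,
      fun s x u v b q => (runs_fetch i _ _ u v b q [] d a).of_eq ?_ ?_⟩
    · simpa [val] using (length_pieceAt_le a _).trans (by simp)
    · cases d <;> simp [val]
    · simp only [Polynomial.eval_mul, Polynomial.eval_natCast, Nat.cast_id, Polynomial.eval_add,
        Polynomial.eval_ofNat, Polynomial.eval_X, List.length_drop]
      gcongr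
      omega

/-- Equality of two strings can be tested. -/
theorem dec_eq (e e' : Ref ι) : Dec C fun s x => e.val s x = e'.val s x := by
  obtain ⟨t, n, hn, h⟩ := e.runs_load true
  obtain ⟨t', n', hn', h'⟩ := e'.runs_load false
  refine ⟨.seq (e.load true) (.seq (e'.load false) compareWords),
    t + t' + (4 * (Polynomial.X + (n : Polynomial ℕ)) +
      2 * (Polynomial.X + (n' : Polynomial ℕ)) + 8), fun s x b q _ =>
    (Runs.seq (h s x [] [] b q) (Runs.seq (h' s x _ _ b q) (runs_compareWords _ _ b q _ _ _))).of_eq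
      ?_ ?_⟩
  · simp only [cfg, cond_true, cond_false, List.append_nil, List.reverse_inj]
    congr!
  · have := hn s x
    have := hn' s x
    simp
    omega

end Decision

section Loops

/-- Run `p` for all positions of the pointer `i`. -/
def forPositions (i : ι) (p : Prog (Stk ι)) : Prog (Stk ι) :=
  .seq (drain (right i) fun c => .seq (.push (right i) c) (.seq p
    (.popCase (right i) fun _ => .push (left i) c))) (move (left i) (right i))

/-- The functions `b` and `q` are loop invariants: the truth values and the counter after k rounds.
In each round the popped symbol is put back before `p` runs, so that `p` sees the pointer at k, and
is transferred to the left stack afterwards. The final `move` returns the pointer to 0, which makes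
nested loops possible. -/
theorem runs_forPositions (i : ι) (p : Prog (Stk ι)) (s : List Sym) (x : ι → ℕ) (hx : x i = 0)
    (b q : ℕ → List Sym) (t : ℕ)
    (h : ∀ k < s.length, Runs p (cfg s (update x i k) (b k) (q k))
      (cfg s (update x i k) (b (k + 1)) (q (k + 1))) t) :
    Runs (forPositions i p) (cfg s x (b 0) (q 0)) (cfg s x (b s.length) (q s.length))
      (s.length * (t + 6) + 4) := by
  have loop : ∀ d k, k + d = s.length →
      Runs (drain (right i) fun c => .seq (.push (right i) c) (.seq p
        (.popCase (right i) fun _ => .push (left i) c))) (cfg s (update x i k) (b k) (q k))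
        (cfg s (update x i s.length) (b s.length) (q s.length)) (d * (t + 4) + 2) := by
    intro d
    induction d with
    | zero =>
      intro k hk
      obtain rfl : k = s.length := by omega
      exact (drain_nil (by simp [cfg])).mono (by omega)
    | succ d ih =>
      intro k hk
      have hk' : k < s.length := by omega
      refine (drain_cons (c := s[k]) (l := s.drop (k + 1)) ?_ (Runs.seq (Runs.push_eq (S' :=
        cfg s (update x i k) (b k) (q k)) ?_) (Runs.seq (h k hk') (Runs.popCase (Runs.push_eq ?_))))
        (ih (k + 1) (by omega))).mono (by linarith)
      · simp [cfg]
      · simp only [cfg, all_right, update_right]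
        congr 1
        funext j
        rcases eq_or_ne j i with rfl | hj <;> simp [*]
      · simp only [cfg, all_right, all_left, update_right, update_left]
        congr 1 <;> funext j <;> rcases eq_or_ne j i with rfl | hj
        · rw [update_self, update_self, update_self, List.take_succ_eq_append_getElem hk',
            List.reverse_append]
          rfl
        all_goals simp [*]
  refine (Runs.seq ((loop s.length 0 (by omega)).start (by rw [← hx, update_eq_self]))
    (runs_move (by simp) _ _ rfl)).of_eq ?_ ?_
  · simp only [cfg, all_right, all_left, update_right, update_left]
    congr 1 <;> funext j <;> rcases eq_or_ne j i with rfl | hj <;> simp [*]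
  · simp [cfg]
    linarith

/-- The topmost truth value starts as `false` and accumulates the disjunction over the positions
visited so far. -/
theorem Dec.exists_position {i : ι} (h : Dec C P) (hi : ∀ x, C' x → x i = 0)
    (hC : ∀ x k, C' x → C (update x i k)) :
    Dec C' fun s x => ∃ k < s.length, P s (update x i k) := by
  classical
  obtain ⟨p, t, h⟩ := h
  refine ⟨.seq (.push truth (.bit false)) (forPositions i (.seq p (.popCase truth fun o =>
    .popCase truth fun o' => .push truth (.bit (o = some (.bit true) ∨ o' = some (.bit true)))))),
    Polynomial.X * (t + 9) + 5, fun s x b q hx => ?_⟩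
  refine (Runs.seq (Runs.push _ _ _) ((runs_forPositions i _ s x (hi x hx)
    (fun n => .bit (decide (∃ k < n, P s (update x i k))) :: b) (fun _ => q)
    (t.eval s.length + 3) fun k _ => ?_).start (by simp [cfg]))).of_eq (by congr!) ?_
  · refine Runs.seq (h s _ _ q (hC x k hx)) (Runs.popCase (Runs.popCase (Runs.push_eq ?_)))
    simp only [cfg, all_truth, List.head?_cons, update_truth, List.tail_cons]
    congr 3
    rw [Bool.eq_iff_iff]
    simp only [Option.some.injEq, Sym.bit.injEq, decide_eq_true_eq]
    simp only [Nat.lt_succ_iff_lt_or_eq, or_and_right, exists_or, exists_eq_left, or_comm]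
  · simp
    linarith

theorem Cnt.congr (h : Cnt C N) (hN : ∀ s x, C x → N s x = N' s x) : Cnt C N' := by
  obtain ⟨p, t, h⟩ := h
  exact ⟨p, t, fun s x b q hx => hN s x hx ▸ h s x b q hx⟩

theorem Cnt.const (n : ℕ) : Cnt C fun _ _ => n :=
  ⟨pushes count (List.replicate n (.bit true)), (n : Polynomial ℕ) + 1, fun s x b q _ =>
    (runs_pushes _ _).of_eq (by simp [cfg]) (by simp)⟩

theorem Cnt.add (h : Cnt C N) (h' : Cnt C N') : Cnt C fun s x => N s x + N' s x := by
  obtain ⟨p, t, h⟩ := h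
  obtain ⟨p', t', h'⟩ := h'
  refine ⟨.seq p p', t + t', fun s x b q hx =>
    (Runs.seq (h s x b q hx) (h' s x b _ hx)).of_eq ?_ (by simp)⟩
  rw [← List.append_assoc, ← List.replicate_add, add_comm]

theorem Cnt.sum {η : Type*} (F : Finset η) {N : η → List Sym → (ι → ℕ) → ℕ}
    (h : ∀ a ∈ F, Cnt C (N a)) : Cnt C fun s x => ∑ a ∈ F, N a s x := by
  classical
  induction F using Finset.induction_on with
  | empty => simpa using Cnt.const 0
  | @insert a F ha ih =>
    exact ((h a (by simp)).add (ih fun b hb => h b (by simp [hb]))).congr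
      fun s x _ => (Finset.sum_insert (f := fun a => N a s x) ha).symm

open scoped Classical in
theorem Cnt.ite (h : Dec C P) (h' : Cnt C N) :
    Cnt C fun s x => if P s x then N s x else 0 := by
  obtain ⟨p, t, h⟩ := h
  obtain ⟨p', t', h'⟩ := h'
  refine ⟨.seq p (.popCase truth fun o => if o = some (.bit true) then p' else .skip), t + t' + 2,
    fun s x b q hx => (Runs.seq (h s x b q hx) (Runs.popCase (t := t'.eval s.length + 1) ?_)).of_eq
      rfl (by simp; omega)⟩
  by_cases hP : P s x
  · simp only [cfg, all_truth, List.head?_cons, hP, decide_true, if_true, update_truth,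
      List.tail_cons]
    exact (h' s x b q hx).mono (by omega)
  · simp only [cfg, all_truth, List.head?_cons, hP, decide_false, update_truth, List.tail_cons]
    exact (Runs.skip_eq (by simp)).mono (by omega)

theorem Cnt.sum_positions {i : ι} (h : Cnt C N) (hi : ∀ x, C' x → x i = 0)
    (hC : ∀ x k, C' x → C (update x i k)) :
    Cnt C' fun s x => ∑ k ∈ Finset.range s.length, N s (update x i k) := by
  obtain ⟨p, t, h⟩ := h
  refine ⟨forPositions i p, Polynomial.X * (t + 6) + 4, fun s x b q hx => ?_⟩
  refine ((runs_forPositions i _ s x (hi x hx) (fun _ => b)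
    (fun n => List.replicate (∑ k ∈ Finset.range n, N s (update x i k)) (.bit true) ++ q)
    (t.eval s.length) fun k _ => ?_).start (by simp)).of_eq rfl (by simp)
  refine (h s _ b _ (hC x k hx)).of_eq ?_ le_rfl
  rw [← List.append_assoc, ← List.replicate_add, Finset.sum_range_succ, add_comm]

end Loops

end Prog

end DB

/-! ### Copying the input, unary arithmetic, and output in lowest terms. -/

namespace DB

theorem encodeNat_eq_bits (n : ℕ) : Computability.encodeNat n = n.bits := by
  have pos (p : PosNum) : Computability.encodePosNum p = (p : ℕ).bits := by
    induction p with
    | one => simp [Computability.encodePosNum]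
    | bit0 p ih =>
      rw [Computability.encodePosNum, ih, PosNum.cast_bit0, ← two_mul,
        Nat.bit0_bits _ (PosNum.cast_pos p).ne']
    | bit1 p ih =>
      rw [Computability.encodePosNum, ih, PosNum.cast_bit1, ← two_mul, Nat.bit1_bits]
  have num (m : Num) : Computability.encodeNum m = (m : ℕ).bits := by
    cases m with
    | zero => simp [Computability.encodeNum]
    | pos p => simpa [Computability.encodeNum] using pos p
  rw [Computability.encodeNat, num, Num.to_of_nat]

theorem bits_eq_cons {n : ℕ} (hn : n ≠ 0) :
    n.bits = decide (n % 2 = 1) :: (n / 2).bits := by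
  conv_lhs => rw [← Nat.bit_bodd_div2 n]
  rw [Nat.bits_append_bit, Nat.div2_val, Nat.mod_two_of_bodd]
  · cases n.bodd <;> simp
  · intro h
    rw [Nat.div2_val] at h
    have : n = 1 := by omega
    simp [this]

/-- The lowest terms of a nonnegative fraction. -/
theorem encodeRat_div (n m : ℕ) (hm : 0 < m) : encodeRat ((n : ℚ) / m) =
    Sym.bit false :: (encodeWord (n / Nat.gcd n m).bits ++ encodeWord (m / Nat.gcd n m).bits) := by
  have h₁ : ¬ ((n : ℚ) / m < 0) := not_lt.2 (by positivity)
  have hg : 0 < Nat.gcd n m := Nat.gcd_pos_of_pos_right n hm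
  have hm' : (0 : ℤ) < (m / Nat.gcd n m : ℕ) :=
    Int.natCast_pos.2 (Nat.div_pos (Nat.le_of_dvd hm (Nat.gcd_dvd_right n m)) hg)
  have hc : Nat.Coprime ((n / Nat.gcd n m : ℕ) : ℤ).natAbs ((m / Nat.gcd n m : ℕ) : ℤ).natAbs :=
    Nat.coprime_div_gcd_div_gcd hg
  have h : (n : ℚ) / m = ((n / Nat.gcd n m : ℕ) : ℤ) / ((m / Nat.gcd n m : ℕ) : ℤ) := by
    rw [Int.cast_natCast, Int.cast_natCast, Nat.cast_div (Nat.gcd_dvd_left n m) (by positivity),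
      Nat.cast_div (Nat.gcd_dvd_right n m) (by positivity),
      div_div_div_cancel_right₀ (by positivity)]
  have h₂ : ((n : ℚ) / m).num = (n / Nat.gcd n m : ℕ) := by
    rw [h, Rat.num_div_eq_of_coprime hm' hc]
  have h₃ : ((n : ℚ) / m).den = m / Nat.gcd n m := by
    have := Rat.den_div_eq_of_coprime hm' hc
    rw [← h] at this
    exact_mod_cast this
  rw [encodeRat, h₂, h₃, encodeNat_eq_bits, encodeNat_eq_bits, Int.natAbs_natCast]
  simp [h₁]

theorem eval_mono (t : Polynomial ℕ) {m n : ℕ} (h : m ≤ n) : t.eval m ≤ t.eval n := by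
  rw [Polynomial.eval_eq_sum_range, Polynomial.eval_eq_sum_range]
  gcongr

namespace Prog

open Function Stk

/-- A step pushes at most one symbol. Applied to the unary counter, this bounds the numerator by the
running time, so no separate estimate of the count is needed. -/
theorem Runs.length_le {K : Type} [DecidableEq K] {p : Prog K} {S S' : K → List Sym} {t : ℕ}
    (h : Runs p S S' t) (k : K) : (S' k).length ≤ (S k).length + t := by
  have pop (S : K → List Sym) (j : K) :
      (update S j (S j).tail k).length ≤ (S k).length := by
    by_cases hk : k = j
    · subst hk
      simp
    · simp [hk]
  induction h with
  | skip S => omega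
  | push j c S =>
    by_cases hk : k = j
    · subst hk
      simp
    · simp [hk]
  | seq _ _ ih₁ ih₂ => omega
  | @popCase j p S S' t _ ih =>
    have := pop S j
    omega
  | @loop_exit j go p S S' t _ _ ih =>
    have := pop S j
    omega
  | @loop_next j go p S S' S'' t t' _ _ _ ih₁ ih₂ =>
    have := pop S j
    omega
  | mono _ _ ih => omega

variable {ι : Type} [DecidableEq ι]

section Setup

theorem runs_pushAll (c : Sym) (l : ι → List Sym) (x u v b q o : List Sym) :
    ∀ (L : List ι), L.Nodup → ∀ r : ι → List Sym,
      Runs (seqs (L.map fun i => .push (right i) c)) (all l r x u v b q o)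
        (all l (fun i => if i ∈ L then c :: r i else r i) x u v b q o) (L.length + 1)
  | [], _, r => Runs.skip_eq (by simp)
  | i :: L, hL, r => by
    rw [List.nodup_cons] at hL
    refine (Runs.seq (Runs.push_eq rfl) ((runs_pushAll c l x u v b q o L hL.2
      (update r i (c :: r i))).start (by simp))).of_eq ?_ (by simp; omega)
    congr 1
    funext j
    by_cases hj : j = i
    · subst hj
      simp [hL.1]
    · simp [hj]

theorem runs_clearAll (l : ι → List Sym) (x u v b q o : List Sym) (n : ℕ) :
    ∀ (L : List ι) (r : ι → List Sym), (∀ i, (r i).length ≤ n) →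
      Runs (seqs (L.map fun i => clear (right i))) (all l r x u v b q o)
        (all l (fun i => if i ∈ L then [] else r i) x u v b q o) (L.length * (2 * n + 2) + 1)
  | [], r, _ => Runs.skip_eq (by simp) |>.mono (by simp)
  | i :: L, r, hr => by
    have hr' : ∀ j, (update r i [] j).length ≤ n := by
      intro j
      by_cases hj : j = i
      · subst hj
        simp
      · simpa [hj] using hr j
    refine (Runs.seq (runs_clear (k := right i) _ _ rfl) ((runs_clearAll l x u v b q o n L
      (update r i []) hr').start (by simp))).of_eq ?_ ?_
    · congr 1
      funext j
      by_cases hj : j = i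
      · subst hj
        simp
      · simp [hj]
    · have := hr i
      simp
      linarith

variable [Fintype ι]

/-- Put a copy of the input on the right of every pointer. -/
noncomputable def setup (i₀ : ι) : Prog (Stk ι) :=
  .seq (move (right i₀) aux)
    (drain aux fun c => seqs (Finset.univ.toList.map fun i => .push (right i) c))

theorem runs_setup (i₀ : ι) (s : List Sym) :
    Runs (setup i₀) (update (fun _ => []) (right i₀) s) (cfg s 0 [] [])
      ((Fintype.card ι + 4) * (s.length + 1)) := by
  have copy : ∀ x r : List Sym,
      Runs (drain aux fun c => seqs (Finset.univ.toList.map fun i : ι => .push (right i) c))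
        (all (fun _ => []) (fun _ => r) x [] [] [] [] [])
        (all (fun _ => []) (fun _ => x.reverse ++ r) [] [] [] [] [] [])
        ((Fintype.card ι + 2) * x.length + 2) := by
    intro x
    induction x with
    | nil => exact fun r => (drain_nil rfl).of_eq (by simp) (by simp)
    | cons c x ih =>
      intro r
      refine Runs.of_eq (drain_cons (c := c) (l := x) rfl ((runs_pushAll c _ _ _ _ _ _ _ _
        (Finset.nodup_toList _) _).start (update_aux ..)) ((ih (c :: r)).start (by simp)))
        (by simp) ?_
      simp
      linarith
  have h₀ : update (fun _ => []) (right i₀) s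
      = all (fun _ => []) (update (fun _ : ι => []) i₀ s) [] [] [] [] [] [] := by
    funext k
    cases k <;> simp [update_apply, all]
  refine (Runs.seq ((runs_move (k := right i₀) (k' := aux) (by simp) s _ (by simp)).start h₀)
    ((copy s.reverse []).start ?_)).of_eq ?_ ?_
  · simp
  · simp [cfg]
  · simp
    linarith

/-- Remove the copies of the input. -/
noncomputable def cleanup : Prog (Stk ι) :=
  seqs (Finset.univ.toList.map fun i => clear (right i))

theorem runs_cleanup (s : List Sym) (b q : List Sym) :
    Runs (cleanup (ι := ι)) (cfg s 0 b q) (all (fun _ => []) (fun _ => []) [] [] [] b q [])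
      (Fintype.card ι * (2 * s.length + 2) + 1) :=
  (runs_clearAll _ _ _ _ _ _ _ s.length _ _ (by simp)).of_eq (by simp) (by simp)

end Setup

section Output

/-- A number in unary. -/
abbrev unary (n : ℕ) : List Sym :=
  List.replicate n (.bit true)

variable (l r : ι → List Sym)

/-- Divide the number in `count` by `m`, when `fst` holds `m` in unary. -/
def divide : Prog (Stk ι) :=
  drain count fun _ => .seq (.popCase fst fun _ => .push snd (.bit true))
    (.popCase fst fun o => if o = none then .seq (move snd fst) (.push aux (.bit true))
      else .push fst (.bit true))

/-- Invariant: `snd` holds the current remainder k, `fst` its complement m - k, and `aux` the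
quotient so far. When `fst` runs empty, m units lie in `snd`; they are moved back and the quotient
grows by one. -/
theorem runs_divide (b o : List Sym) (m : ℕ) : ∀ n k c, k < m →
    Runs divide (all l r (unary c) (unary (m - k)) (unary k) b (unary n) o)
      (all l r (unary (c + (k + n) / m)) (unary (m - (k + n) % m)) (unary ((k + n) % m)) b [] o)
      (n * (2 * m + 7) + 2)
  | 0, k, c, hk => (drain_nil rfl).of_eq (by simp [Nat.div_eq_of_lt hk, Nat.mod_eq_of_lt hk])
      (by simp)
  | n + 1, k, c, hk => by
    by_cases h : k + 1 = m
    · refine Runs.of_eq (drain_cons (c := .bit true) (l := unary n) rfl (Runs.seq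
        (Runs.popCase (Runs.push_eq rfl)) (Runs.popCase (t := 2 * m + 3)
        (S' := all l r (unary (c + 1)) (unary m) (unary 0) b (unary n) o) ?_))
        ((runs_divide b o m n 0 (c + 1) (by omega)).start (by simp))) ?_ ?_
      · obtain rfl := h
        have e : unary k ++ [.bit true] = .bit true :: unary k := by
          rw [← List.replicate_succ', List.replicate_succ]
        simp only [Nat.add_sub_cancel_left, List.replicate_one]
        refine (Runs.seq (runs_move (by simp) _ _ rfl) (Runs.push_eq ?_)).mono (by simp)
        simp [List.replicate_succ, e]
      · have h₁ : k + (n + 1) = 0 + n + m := by omega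
        rw [h₁, Nat.add_div_right _ (by omega), Nat.add_mod_right, add_right_comm,
          add_assoc c]
      · linarith
    · refine Runs.of_eq (drain_cons (c := .bit true) (l := unary n) rfl (Runs.seq
        (Runs.popCase (Runs.push_eq rfl)) (Runs.popCase (t := 1)
        (S' := all l r (unary c) (unary (m - (k + 1))) (unary (k + 1)) b (unary n) o) ?_))
        (runs_divide b o m n (k + 1) c (by omega))) ?_ ?_
      · obtain ⟨d, hd⟩ : ∃ d, m - k = d + 2 := ⟨m - k - 2, by omega⟩
        have hd' : m - (k + 1) = d + 1 := by omega
        simp [hd, hd', List.replicate_succ]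
        exact Runs.push_eq (by simp)
      · rw [show k + (n + 1) = k + 1 + n by ring]
      · linarith

/-- Remove the unary number `j` from `snd` and go on with `p j`. -/
def readSnd (p : ℕ → Prog (Stk ι)) : ℕ → ℕ → Prog (Stk ι)
  | 0, j => p j
  | f + 1, j => .popCase snd fun o => if o = none then p j else readSnd p f (j + 1)

/-- This turns a bounded number on a stack into a case distinction of the program, which can then
treat that number as a constant. -/
theorem runs_readSnd {p : ℕ → Prog (Stk ι)} {x u b q o : List Sym} {S' : Stk ι → List Sym}
    {t : ℕ} : ∀ f j k, k ≤ f → Runs (p (j + k)) (all l r x u [] b q o) S' t →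
      Runs (readSnd p f j) (all l r x u (unary k) b q o) S' (t + f)
  | 0, j, k, hk, h => by
    obtain rfl : k = 0 := by omega
    exact h
  | f + 1, j, 0, hk, h => by
    refine Runs.mono (Runs.popCase (t := t) ?_) (by omega)
    simpa using h
  | f + 1, j, k + 1, hk, h => by
    have h₁ := runs_readSnd f (j + 1) k (by omega) (by rwa [add_assoc, add_comm 1])
    refine Runs.mono (Runs.popCase (t := t + f) ?_) (by omega)
    simpa [List.replicate_succ] using h₁

/-- Replace the number `c` in `aux` by the number `m * c` in `count`. -/
def multiply (m : ℕ) : Prog (Stk ι) :=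
  drain aux fun _ => pushes count (unary m)

theorem runs_multiply (m : ℕ) (u v b o : List Sym) : ∀ c n,
    Runs (multiply m) (all l r (unary c) u v b (unary n) o)
      (all l r [] u v b (unary (m * c + n)) o) (c * (m + 2) + 2)
  | 0, n => (drain_nil rfl).of_eq (by simp) (by simp)
  | c + 1, n => by
    refine Runs.of_eq (drain_cons (c := .bit true) (l := unary c) rfl (runs_pushes _ _)
      ((runs_multiply m u v b o c (m + n)).start ?_)) ?_ ?_
    · simp [Nat.add_comm m n]
    · rw [mul_add, mul_one, add_assoc]
    · simp
      linarith

/-- Replace the number `n` in `count` by `n / 2` and push `n % 2` as a bit on `fst`. -/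
def halve : Prog (Stk ι) :=
  .seq (.push fst (.bit false)) (.seq (drain count fun _ => .popCase count fun o =>
    if o = none then .popCase fst fun _ => .push fst (.bit true) else .push aux (.bit true))
    (move aux count))

theorem runs_halve (u v b o : List Sym) (n : ℕ) :
    Runs halve (all l r [] u v b (unary n) o)
      (all l r [] (.bit (decide (n % 2 = 1)) :: u) v b (unary (n / 2)) o) (3 * n + 8) := by
  -- Units are removed in pairs, with one unit on `aux` per pair; an unpaired last unit turns the
  -- prepared bit into `true`.
  have loop : ∀ n c, Runs (drain count fun _ => .popCase count fun o =>
      if o = none then .popCase fst fun _ => .push fst (.bit true) else .push aux (.bit true))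
      (all l r (unary c) (.bit false :: u) v b (unary n) o)
      (all l r (unary (n / 2 + c)) (.bit (decide (n % 2 = 1)) :: u) v b [] o) (2 * n + 4) := by
    intro n
    induction n using Nat.twoStepInduction with
    | zero => exact fun c => (drain_nil rfl).of_eq (by simp) (by simp)
    | one =>
      intro c
      refine Runs.of_eq (drain_cons (c := .bit true) (l := []) rfl (Runs.popCase (t := 2)
        (S' := (all l r (unary c) (.bit true :: u) v b [] o)) ?_) (drain_nil rfl)) (by simp)
        (by simp)
      simpa using Runs.popCase (Runs.push_eq (by simp))
    | more n ih _ =>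
      intro c
      refine Runs.of_eq (drain_cons (c := .bit true) (l := unary (n + 1)) rfl (Runs.popCase (t := 1)
        (S' := (all l r (unary (c + 1)) (.bit false :: u) v b (unary n) o)) ?_) (ih (c + 1))) ?_
        (by omega)
      · simpa [List.replicate_succ] using Runs.push_eq (by simp)
      · rw [show (n + 2) / 2 + c = n / 2 + (c + 1) by omega, show (n + 2) % 2 = n % 2 by omega]
  refine (Runs.seq (Runs.push_eq rfl) (Runs.seq ((loop n 0).start (by simp))
    (runs_move (by simp) _ _ rfl))).of_eq ?_ ?_
  · simp
  · simp
    omega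

/-- Replace the unary number in `count` by its binary representation, in `fst`. -/
def binary : Prog (Stk ι) :=
  .loop count Option.isSome fun o => o.elim .skip fun _ => .seq (.push count (.bit true)) halve

/-- Repeated halving produces the least significant bit first, so the bits lie reversed on `fst`
until a `move` restores their order. The unit popped by the loop test is pushed back before halving.
-/
theorem runs_binary (v b o : List Sym) (n : ℕ) : ∀ u,
    Runs binary (all l r [] u v b (unary n) o)
      (all l r [] ((n.bits.map Sym.bit).reverse ++ u) v b [] o) (n * (3 * n + 11) + 2) := by
  induction n using Nat.strong_induction_on with
  | _ n ih =>
    intro u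
    rcases Nat.eq_zero_or_pos n with rfl | hn
    · exact (drain_nil rfl).of_eq (by simp) (by simp)
    · obtain ⟨k, rfl⟩ : ∃ k, n = k + 1 := ⟨n - 1, by omega⟩
      refine Runs.of_eq (Runs.loop_next (t := 3 * (k + 1) + 9) rfl ?_
        (ih ((k + 1) / 2) (by omega) (.bit (decide ((k + 1) % 2 = 1)) :: u))) ?_ ?_
      · refine (Runs.seq (Runs.push_eq rfl) ((runs_halve l r u v b o (k + 1)).start ?_)).mono
          (by omega)
        simp [List.replicate_succ]
      · rw [bits_eq_cons (n := k + 1) (by omega)]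
        simp
      · have h : (k + 1) / 2 ≤ k := by omega
        have : (k + 1) / 2 * (3 * ((k + 1) / 2) + 11) ≤ k * (3 * (k + 1) + 11) := by
          gcongr
          omega
        linarith

/-- Write the fraction `(m * c + k) / m` in lowest terms, where `aux` holds `c` in unary. -/
def writeFraction (m k : ℕ) : Prog (Stk ι) :=
  .seq (multiply (m / Nat.gcd k m)) <| .seq (pushes count (unary (k / Nat.gcd k m))) <|
  .seq (pushes out (encodeWord (m / Nat.gcd k m).bits).reverse) <|
  .seq (.push out .endWord) <| .seq binary <| .seq (move fst out) (.push out (.bit false))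

/-- The gcd g of n and m is also that of n % m and m, so the program may depend on it. The reduced
numerator is n / g = (m / g) · (n / m) + (n % m) / g, which only requires multiplying the quotient
by a constant and adding a constant. -/
theorem runs_writeFraction (b : List Sym) (m : ℕ) (hm : 0 < m) (n : ℕ) :
    Runs (writeFraction m (n % m)) (all l r (unary (n / m)) [] [] b [] [])
      (all l r [] [] [] b [] (encodeRat ((n : ℚ) / m)))
      (n * (m + 2) + n * (3 * n + 11) + 2 * n + 2 * m + 11) := by
  have hg : 0 < Nat.gcd n m := Nat.gcd_pos_of_pos_right n hm
  have hgcd : Nat.gcd (n % m) m = Nat.gcd n m := by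
    rw [← Nat.gcd_rec, Nat.gcd_comm]
  have hn : m / Nat.gcd n m * (n / m) + n % m / Nat.gcd n m = n / Nat.gcd n m := by
    obtain ⟨d, hd⟩ := Nat.gcd_dvd_right n m
    obtain ⟨e, he⟩ : Nat.gcd n m ∣ n % m := hgcd ▸ Nat.gcd_dvd_left (n % m) m
    have h := Nat.div_add_mod n m
    generalize Nat.gcd n m = g at *
    generalize n % m = k at *
    generalize n / m = c at *
    subst hd he h
    rw [Nat.mul_div_cancel_left _ hg, Nat.mul_div_cancel_left _ hg, mul_assoc, ← mul_add,
      Nat.mul_div_cancel_left _ hg]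
  have size (k : ℕ) : k.bits.length ≤ k := by
    rw [Nat.size_eq_bits_len, Nat.size_le]
    exact Nat.lt_two_pow_self
  rw [writeFraction, hgcd, encodeRat_div n m hm, ← hn]
  generalize hd : m / Nat.gcd n m = d at *
  generalize he : n % m / Nat.gcd n m = e at *
  have hdm : d ≤ m := hd ▸ Nat.div_le_self _ _
  have hem : e ≤ m := he ▸ (Nat.div_le_self _ _).trans (Nat.mod_lt n hm).le
  have hk : d * (n / m) + e ≤ n := hn ▸ Nat.div_le_self _ _
  have hc : n / m ≤ n := Nat.div_le_self _ _
  generalize n / m = c at *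
  refine (Runs.seq ((runs_multiply l r d [] [] b [] c 0).start rfl) <|
    Runs.seq (runs_pushes _ _) <| Runs.seq (runs_pushes _ _) <| Runs.seq (Runs.push_eq rfl) <|
    Runs.seq ((runs_binary l r [] b (.endWord :: encodeWord d.bits) (d * c + e) []).start ?_) <|
    Runs.seq (runs_move (by simp) _ _ rfl) <| Runs.push_eq ?_).mono ?_
  · simp [Nat.add_comm e]
  · simp [encodeWord]
  · have h₁ := size d
    have h₂ := size (d * c + e)
    have h₃ : (d * c + e) * (3 * (d * c + e) + 11) ≤ n * (3 * n + 11) := by gcongr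
    have h₄ : c * (d + 2) ≤ n * (m + 2) := by gcongr
    simp [encodeWord]
    linarith

/-- Write the number in `count`, divided by `m`, in lowest terms. -/
def writeOutput (m : ℕ) : Prog (Stk ι) :=
  .seq (pushes fst (unary m)) (.seq divide (.seq (clear fst) (readSnd (writeFraction m) m 0)))

theorem runs_writeOutput (b : List Sym) (m : ℕ) (hm : 0 < m) : ∃ t : Polynomial ℕ, ∀ n,
    Runs (writeOutput m) (all l r [] [] [] b (unary n) [])
      (all l r [] [] [] b [] (encodeRat ((n : ℚ) / m))) (t.eval n) := by
  have hk (n : ℕ) : n % m ≤ m := (Nat.mod_lt n hm).le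
  refine ⟨(m : Polynomial ℕ) + 1 + (Polynomial.X * (2 * (m : Polynomial ℕ) + 7) + 2) +
    (2 * (m : Polynomial ℕ) + 2) + (Polynomial.X * ((m : Polynomial ℕ) + 2) + Polynomial.X *
    (3 * Polynomial.X + 11) + 2 * Polynomial.X + 2 * (m : Polynomial ℕ) + 11 + (m : Polynomial ℕ)),
    fun n => (Runs.seq (runs_pushes _ _) (Runs.seq ((runs_divide l r b [] m n 0 0 hm).start ?_)
      (Runs.seq (runs_clear _ _ rfl) ((runs_readSnd (x := unary (n / m)) l r m 0 _ (hk n)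
        (by rw [zero_add]; exact runs_writeFraction l r b m hm n)).start ?_)))).mono ?_⟩
  · simp
  · simp
  · have : m - n % m ≤ m := Nat.sub_le _ _
    simp
    linarith

end Output

end Prog

end DB

/-! ### The Shapley value of a game that counts subsets. -/

namespace DB

open Finset

open scoped Classical in
/-- The number of linear orderings of `D` in which `α` is the last element of `S`. -/
theorem card_last_mul {F : Type*} (D : Finset F) (S : Finset D) (α : D) (hα : α ∈ S) :
    #{π : D ≃ Fin #D | ∀ β ∈ S, π β ≤ π α} * #S = Fintype.card (D ≃ Fin #D) := by
  -- Exchanging α and γ in an ordering preserves S, so every element of S is last equally often.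
  have symm (γ : D) (hγ : γ ∈ S) : #{π : D ≃ Fin #D | ∀ β ∈ S, π β ≤ π γ}
      = #{π : D ≃ Fin #D | ∀ β ∈ S, π β ≤ π α} := by
    have hs (β : D) (hβ : β ∈ S) : Equiv.swap α γ β ∈ S := by
      rw [Equiv.swap_apply_def]
      split_ifs <;> assumption
    refine card_bij' (fun π _ => (Equiv.swap α γ).trans π) (fun π _ => (Equiv.swap α γ).trans π)
      ?_ ?_ ?_ ?_
    · intro π hπ
      simp only [mem_filter, mem_univ, true_and] at hπ ⊢
      intro β hβ
      simpa using hπ _ (hs β hβ)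
    · intro π hπ
      simp only [mem_filter, mem_univ, true_and] at hπ ⊢
      intro β hβ
      simpa using hπ _ (hs β hβ)
    · intro π _
      ext
      simp
    · intro π _
      ext
      simp
  -- Each ordering has exactly one last element of S, so these equally large classes partition the
  -- orderings.
  have part : (univ : Finset (D ≃ Fin #D))
      = S.biUnion fun γ => {π : D ≃ Fin #D | ∀ β ∈ S, π β ≤ π γ} := by
    ext π
    simp only [mem_univ, mem_biUnion, mem_filter, true_and, true_iff]
    exact exists_max_image S π ⟨α, hα⟩
  have disj : (S : Set D).PairwiseDisjoint
      fun γ => ({π : D ≃ Fin #D | ∀ β ∈ S, π β ≤ π γ} : Finset (D ≃ Fin #D)) := by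
    intro γ hγ δ hδ hne
    rw [Function.onFun, disjoint_left]
    intro π hπ hπ'
    simp only [mem_filter, mem_univ, true_and] at hπ hπ'
    exact hne (π.injective (le_antisymm (hπ' γ hγ) (hπ δ hδ)))
  have h := congrArg card part
  rw [card_univ, card_biUnion disj, sum_congr rfl symm, sum_const, smul_eq_mul, mul_comm] at h
  exact h.symm

open scoped Classical in
/-- The Shapley value for the number of the sets with property `P` that are contained in a set. -/
theorem shapley_card {F : Type*} (D : Finset F) (P : Finset F → Prop) (α : D) :
    shapley D (fun B => (#{S ∈ B.powerset | P S} : ℝ)) α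
      = ∑ S ∈ D.powerset with P S ∧ (α : F) ∈ S, (1 : ℝ) / #S := by
  have hcard : (Fintype.card (D ≃ Fin #D) : ℝ) ≠ 0 := by
    rw [Fintype.card_equiv D.equivFin]
    positivity
  -- A set is gained by adding α to its predecessors exactly when it contains α and all its elements
  -- come no later than α.
  have term (π : D ≃ Fin #D) : ∀ B : Finset F,
      B = (univ.filter fun β : D => π β < π α).map (Function.Embedding.subtype _) →
      (#{S ∈ (insert (α : F) B).powerset | P S} : ℝ) - #{S ∈ B.powerset | P S}
        = ∑ S ∈ D.powerset with P S ∧ (α : F) ∈ S,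
          if ∀ β : D, (β : F) ∈ S → π β ≤ π α then (1 : ℝ) else 0 := by
    intro B hB
    have hmem (β : D) : (β : F) ∈ B ↔ π β < π α := by simp [hB]
    have hBD : B ⊆ D := by
      intro x
      simp only [hB, mem_map, mem_filter, mem_univ, true_and, Function.Embedding.subtype_apply]
      rintro ⟨y, _, rfl⟩
      exact y.2
    have hsub : ({S ∈ B.powerset | P S}) ⊆ ({S ∈ (insert (α : F) B).powerset | P S}) :=
      filter_subset_filter _ (powerset_mono.2 (subset_insert _ _))
    rw [← Nat.cast_sub (card_le_card hsub), ← card_sdiff_of_subset hsub, ← sum_filter, sum_const,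
      nsmul_eq_mul, mul_one]
    congr 2
    ext S
    simp only [mem_sdiff, mem_filter, mem_powerset]
    constructor
    · rintro ⟨⟨h₁, h₂⟩, h₃⟩
      have hα : (α : F) ∈ S := by
        by_contra hα
        exact h₃ ⟨(subset_insert_iff_of_notMem hα).1 h₁, h₂⟩
      refine ⟨⟨h₁.trans (insert_subset α.2 hBD), h₂, hα⟩, fun β hβ => ?_⟩
      rcases mem_insert.1 (h₁ hβ) with h | h
      · rw [Subtype.ext h]
      · exact ((hmem β).1 h).le
    · rintro ⟨⟨h₁, h₂, h₃⟩, h₄⟩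
      refine ⟨⟨fun x hx => ?_, h₂⟩, fun h => ?_⟩
      · rcases (h₄ ⟨x, h₁ hx⟩ hx).lt_or_eq with h | h
        · exact mem_insert_of_mem ((hmem _).2 h)
        · exact mem_insert.2 (Or.inl (congrArg Subtype.val (π.injective h)))
      · exact lt_irrefl _ ((hmem α).1 (h.1 h₃))
  -- Exchanging the sums leaves, for each S, the fraction of orderings in which α comes last in S.
  rw [shapley, sum_congr rfl fun π _ => term π _ rfl, sum_comm, sum_div]
  refine sum_congr rfl fun S hS => ?_
  simp only [mem_filter, mem_powerset] at hS
  have h := card_last_mul D (S.subtype (· ∈ D)) α (by simpa using hS.2.2)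
  have hS' : #(S.subtype (· ∈ D)) = #S := by
    rw [card_subtype, filter_true_of_mem hS.1]
  rw [hS'] at h
  have hpos : (#S : ℝ) ≠ 0 := Nat.cast_ne_zero.2 (card_ne_zero_of_mem hS.2.2)
  rw [div_eq_div_iff hcard hpos, ← h, ← sum_filter, sum_const]
  simp

end DB

/-! ### Counting minimal sets by tuples. -/

namespace DB

open Finset

section Tuples

variable {F : Type*} [DecidableEq F] {Sup : Finset F → Prop} {D : Finset F} {α : F} {m : ℕ}

/-- The element `α` and the components of `y` form a set with property `Sup`, which is lost as soon
as `α` or a component of `y` is omitted. -/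
def Critical (Sup : Finset F → Prop) (α : F) (y : Fin m → F) : Prop :=
  Sup (insert α (univ.image y)) ∧ ¬ Sup (univ.image y) ∧
    ∀ j, ¬ Sup (insert α ((univ.erase j).image y))

/-- By monotonicity, a proper subset with `Sup` would give one that lacks just a single element.
Injectivity and avoidance of α come for free, since a redundant component could be omitted without
changing the set. -/
theorem critical_iff (hmono : ∀ S T, S ⊆ T → T ⊆ D → Sup S → Sup T) (hα : α ∈ D)
    {y : Fin m → F} (hy : ∀ j, y j ∈ D) :
    Critical Sup α y ↔
      Function.Injective y ∧ (∀ j, y j ≠ α) ∧ Minimal Sup (insert α (univ.image y)) := by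
  have hD : univ.image y ⊆ D := by
    intro x
    simp only [mem_image, mem_univ, true_and]
    rintro ⟨j, rfl⟩
    exact hy j
  constructor
  · rintro ⟨h₁, h₂, h₃⟩
    -- A component that is α or equals another component is redundant, which contradicts `h₃`.
    have eq_of (j : Fin m) (hj : y j ∈ insert α ((univ.erase j).image y)) : False := by
      refine h₃ j ?_
      convert h₁ using 1
      refine (insert_subset_insert _ (image_subset_image (erase_subset _ _))).antisymm ?_
      refine insert_subset (mem_insert_self _ _) ?_
      intro x hx
      obtain ⟨i, _, rfl⟩ := mem_image.1 hx
      by_cases hij : i = j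
      · rwa [hij]
      · exact mem_insert_of_mem (mem_image_of_mem _ (mem_erase.2 ⟨hij, mem_univ _⟩))
    refine ⟨fun i j hij => ?_, fun j hj => eq_of j (by simp [hj]), h₁, fun T hT hTS => ?_⟩
    · by_contra hne
      exact eq_of j (mem_insert_of_mem (mem_image.2 ⟨i, by simp [hne], hij⟩))
    · by_contra hST
      obtain ⟨x, hx, hxT⟩ := not_subset.1 hST
      rcases mem_insert.1 hx with rfl | hx
      · exact h₂ (hmono T _ ((subset_insert_iff_of_notMem hxT).1 hTS) hD hT)
      · obtain ⟨j, _, rfl⟩ := mem_image.1 hx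
        refine h₃ j (hmono T _ (fun z hz => ?_) (insert_subset hα
          ((image_subset_image (erase_subset _ _)).trans hD)) hT)
        rcases mem_insert.1 (hTS hz) with rfl | hz'
        · simp
        · obtain ⟨i, _, rfl⟩ := mem_image.1 hz'
          refine mem_insert_of_mem (mem_image_of_mem _ (mem_erase.2 ⟨?_, mem_univ _⟩))
          rintro rfl
          exact hxT hz
  · rintro ⟨h₁, h₂, h₃⟩
    refine ⟨h₃.prop, fun h => ?_, fun j h => ?_⟩
    · have := h₃.le_of_le h (subset_insert _ _) (mem_insert_self _ _)
      obtain ⟨j, _, hj⟩ := mem_image.1 this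
      exact h₂ j hj
    · have := h₃.le_of_le h (insert_subset_insert _ (image_subset_image (erase_subset _ _)))
        (mem_insert_of_mem (mem_image_of_mem y (mem_univ j)))
      rcases mem_insert.1 this with hj | hj
      · exact h₂ j hj
      · obtain ⟨i, hi, hij⟩ := mem_image.1 hj
        exact (mem_erase.1 hi).1 (h₁ hij)

open scoped Classical in
/-- The number of critical tuples of length `m`. -/
theorem card_critical (hmono : ∀ S T, S ⊆ T → T ⊆ D → Sup S → Sup T) (hα : α ∈ D) :
    #{y : Fin m → D | Critical Sup α fun j => (y j : F)}
      = #{S ∈ D.powerset | (Minimal Sup S ∧ α ∈ S) ∧ #S = m + 1} * m.factorial := by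
  let g (y : Fin m → D) : Finset F := insert α (univ.image fun j => (y j : F))
  have crit (y : Fin m → D) := critical_iff (m := m) hmono hα (y := fun j => (y j : F))
    fun j => (y j).2
  have hg : ∀ y ∈ ({y : Fin m → D | Critical Sup α fun j => (y j : F)} : Finset _),
      g y ∈ ({S ∈ D.powerset | (Minimal Sup S ∧ α ∈ S) ∧ #S = m + 1} : Finset _) := by
    intro y hy
    obtain ⟨h₁, h₂, h₃⟩ := (crit y).1 (mem_filter.1 hy).2
    refine mem_filter.2 ⟨mem_powerset.2 (insert_subset hα ?_), ⟨h₃, mem_insert_self _ _⟩, ?_⟩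
    · intro x hx
      obtain ⟨j, _, rfl⟩ := mem_image.1 hx
      exact (y j).2
    · rw [card_insert_of_notMem, card_image_of_injective _ h₁, card_univ, Fintype.card_fin]
      intro h
      obtain ⟨j, _, hj⟩ := mem_image.1 h
      exact h₂ j hj
  -- The fibre over S consists of the bijections from `Fin m` to S ∖ {α}, of which there are m!.
  rw [card_eq_sum_card_fiberwise hg, sum_const_nat]
  intro S hS
  simp only [mem_filter, mem_powerset] at hS
  obtain ⟨hSD, ⟨hmin, hαS⟩, hcard⟩ := hS
  have hcard' : #(S.erase α) = m := by rw [card_erase_of_mem hαS, hcard, Nat.add_sub_cancel]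
  have hperm : #(univ : Finset (Fin m ≃ ↥(S.erase α))) = m.factorial := by
    rw [card_univ, Fintype.card_equiv (Fintype.equivOfCardEq (by simp [hcard'])), Fintype.card_fin]
  rw [← hperm]
  symm
  refine card_bij (fun e _ j => ⟨(e j : F), hSD (mem_of_mem_erase (e j).2)⟩) ?_ ?_ ?_
  · intro e _
    have himg : (univ.image fun j => (e j : F)) = S.erase α := by
      ext x
      simp only [mem_image, mem_univ, true_and]
      constructor
      · rintro ⟨j, rfl⟩
        exact (e j).2
      · exact fun hx => ⟨e.symm ⟨x, hx⟩, by simp⟩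
    have hins : insert α (univ.image fun j => (e j : F)) = S := by rw [himg, insert_erase hαS]
    simp only [mem_filter, mem_univ, true_and]
    refine ⟨(crit fun j => ⟨(e j : F), hSD (mem_of_mem_erase (e j).2)⟩).2 ⟨?_, ?_, ?_⟩, hins⟩
    · exact fun i j hij => e.injective (Subtype.ext hij)
    · exact fun j => (mem_erase.1 (e j).2).1
    · exact hins.symm ▸ hmin
  · intro e _ e' _ h
    ext j
    exact congrArg (fun z : Fin m → D => (z j : F)) h
  · intro y hy
    simp only [mem_filter, mem_univ, true_and] at hy
    obtain ⟨h₁, h₂, h₃⟩ := (crit y).1 hy.1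
    have hmem (j : Fin m) : (y j : F) ∈ S.erase α := by
      rw [mem_erase, ← hy.2]
      exact ⟨h₂ j, mem_insert_of_mem (mem_image_of_mem _ (mem_univ j))⟩
    have hbij : Function.Bijective fun j => (⟨(y j : F), hmem j⟩ : ↥(S.erase α)) := by
      rw [Fintype.bijective_iff_injective_and_card]
      refine ⟨fun i j hij => h₁ (Subtype.mk.inj hij), by simp [hcard']⟩
    exact ⟨Equiv.ofBijective _ hbij, mem_univ _, rfl⟩

-- Grouping by size, the sets with m + 1 elements contribute 1/(m+1) = m!/(m+1)! each, and m! times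
-- their number is the number of critical tuples. The common denominator K! makes all coefficients
-- natural numbers, since m + 1 ≤ K.
open scoped Classical in
theorem sum_minimal (hmono : ∀ S T, S ⊆ T → T ⊆ D → Sup S → Sup T) (hα : α ∈ D) {K : ℕ}
    (hK : ∀ S, Minimal Sup S → #S ≤ K) :
    ∑ S ∈ D.powerset with Minimal Sup S ∧ α ∈ S, (1 : ℝ) / #S
      = ((∑ m ∈ range K, K.factorial / (m + 1).factorial *
          #{y : Fin m → D | Critical Sup α fun j => (y j : F)} : ℕ) : ℝ) / K.factorial := by
  have hfib : ∀ S ∈ ({S ∈ D.powerset | Minimal Sup S ∧ α ∈ S} : Finset _),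
      #S - 1 ∈ range K := by
    intro S hS
    simp only [mem_filter] at hS
    have := hK S hS.2.1
    have := card_pos.2 ⟨α, hS.2.2⟩
    rw [mem_range]
    omega
  rw [← sum_fiberwise_of_maps_to hfib, Nat.cast_sum, sum_div]
  refine sum_congr rfl fun m hm => ?_
  have hset : ({S ∈ ({S ∈ D.powerset | Minimal Sup S ∧ α ∈ S} : Finset _) | #S - 1 = m})
      = {S ∈ D.powerset | (Minimal Sup S ∧ α ∈ S) ∧ #S = m + 1} := by
    rw [filter_filter]
    refine filter_congr fun S _ => and_congr_right fun h => ?_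
    have := card_pos.2 ⟨α, h.2⟩
    omega
  rw [hset, card_critical hmono hα]
  have hterm : ∀ S ∈ ({S ∈ D.powerset | (Minimal Sup S ∧ α ∈ S) ∧ #S = m + 1} : Finset _),
      (1 : ℝ) / #S = 1 / (m + 1 : ℕ) := fun S hS => by rw [(mem_filter.1 hS).2.2]
  rw [sum_congr rfl hterm, sum_const, nsmul_eq_mul, Nat.cast_mul, Nat.cast_div
    (Nat.factorial_dvd_factorial (mem_range.1 hm)) (by positivity), Nat.cast_mul,
    Nat.factorial_succ m, Nat.cast_mul]
  have h₁ : (K.factorial : ℝ) ≠ 0 := by positivity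
  have h₂ : (m.factorial : ℝ) ≠ 0 := by positivity
  have h₃ : ((m + 1 : ℕ) : ℝ) ≠ 0 := by positivity
  field_simp

end Tuples

/-! ### Positive supports: monotonicity and bounded size. -/

section Supports

variable {σ : Schema} {Const : Type*} {Var : Type*} {q : UCQNeg σ Const Var}
  {D S T : Finset (Fact σ Const)}

theorem Atom.sign_injective {U : Type*} (e : Sgn) :
    Function.Injective (Atom.sign e : Atom σ U → Atom σ.signed U) := by
  rintro ⟨R, a⟩ ⟨R', a'⟩ h
  cases h
  rfl

theorem Atom.sign_plus_ne {U : Type*} (a b : Atom σ U) : a.sign .plus ≠ b.sign .minus :=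
  fun h => nomatch congrArg (fun c : Atom σ.signed U => c.rel.1) h

/-- The signs keep the two parts of the signed database apart: positive atoms can only be matched in
S, negated ones only in `negFacts D`. -/
theorem isPositiveSupport_iff : IsPositiveSupport q D S ↔ S ⊆ D ∧ ∃ p ∈ q, ∃ ν : Var → Const,
    (∀ a ∈ p.pos, a.map (Term.eval ν) ∈ S) ∧ (∀ a ∈ p.neg, a.map (Term.eval ν) ∈ negFacts D) ∧
      ∀ e ∈ p.ineq, e.1.eval ν ≠ e.2.eval ν := by
  have plus (a : Fact σ Const) : a.sign .plus ∈ (Atom.sign .plus '' (S : Set (Fact σ Const)) ∪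
      Atom.sign .minus '' negFacts D) ↔ a ∈ S := by
    constructor
    · rintro (⟨b, hb, h⟩ | ⟨b, _, h⟩)
      · exact Atom.sign_injective _ h ▸ hb
      · exact absurd h.symm (Atom.sign_plus_ne _ _)
    · exact fun h => Or.inl ⟨a, h, rfl⟩
  have minus (a : Fact σ Const) : a.sign .minus ∈ (Atom.sign .plus '' (S : Set (Fact σ Const)) ∪
      Atom.sign .minus '' negFacts D) ↔ a ∈ negFacts D := by
    constructor
    · rintro (⟨b, _, h⟩ | ⟨b, hb, h⟩)
      · exact absurd h (Atom.sign_plus_ne _ _)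
      · exact Atom.sign_injective _ h ▸ hb
    · exact fun h => Or.inr ⟨a, h, rfl⟩
  have map (e : Sgn) (a : Atom σ (Term Const Var)) (ν : Var → Const) :
      (a.sign e).map (Term.eval ν) = (a.map (Term.eval ν)).sign e := rfl
  refine and_congr_right fun _ => ?_
  simp only [UCQNeg.Sat, UCQNeg.signed, List.mem_map, exists_exists_and_eq_and, CQNeg.Sat,
    CQNeg.signed, List.mem_append, or_imp, forall_and, forall_exists_index, and_imp,
    forall_apply_eq_imp_iff₂, map, plus, minus, and_assoc]
  simp

/-- The absent facts are taken with respect to D and not to S, so enlarging S destroys nothing. -/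
theorem IsPositiveSupport.mono (hST : S ⊆ T) (hT : T ⊆ D) (h : IsPositiveSupport q D S) :
    IsPositiveSupport q D T := by
  rw [isPositiveSupport_iff] at h ⊢
  obtain ⟨_, p, hp, ν, h₁, h₂⟩ := h
  exact ⟨hT, p, hp, ν, fun a ha => hST (h₁ a ha), h₂⟩

/-- The maximal number of positive atoms of a disjunct. -/
def UCQNeg.width (q : UCQNeg σ Const Var) : ℕ :=
  (q.map fun p => p.pos.length).sum

/-- The instances of the positive atoms of the satisfied disjunct already form a support inside S,
hence exhaust S. The sum `q.width` over all disjuncts bounds their number. -/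
theorem IsMinimalPositiveSupport.card_le (h : IsMinimalPositiveSupport q D S) :
    #S ≤ q.width := by
  classical
  obtain ⟨hS, p, hp, ν, h₁, h₂⟩ := isPositiveSupport_iff.1 h.prop
  have hsub : (p.pos.map fun a => a.map (Term.eval ν)).toFinset ⊆ S := by
    intro f
    simp only [List.mem_toFinset, List.mem_map]
    rintro ⟨a, ha, rfl⟩
    exact h₁ a ha
  have hle := h.le_of_le (isPositiveSupport_iff.2 ⟨hsub.trans hS, p, hp, ν, fun a ha =>
    List.mem_toFinset.2 (List.mem_map_of_mem ha), h₂⟩) hsub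
  refine (card_le_card hle).trans ((List.toFinset_card_le _).trans ?_)
  rw [List.length_map]
  exact List.single_le_sum (by simp) _ (List.mem_map_of_mem hp)

end Supports

end DB

/-! ### Locating facts and constants in the encoded input. -/

namespace DB

/-- The position `p` is the first position of a fact. -/
def IsStart (s : List Sym) (p : ℕ) : Prop :=
  (s.take p).getLast? = none ∨ (s.take p).getLast? = some .endFact

/-- The word `w` occurs in `s` immediately after the end of a word. -/
def OccursAfterWord (s : List Sym) (w : List Bool) : Prop :=
  ∃ p < s.length, (s.take p).getLast? = some .endWord ∧ pieceAt 0 (s.drop p) = encodeWord w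

theorem piece_encodeWord (w : List Bool) (s : List Sym) :
    piece (encodeWord w ++ s) = encodeWord w := by
  induction w with
  | nil => rfl
  | cons b w ih => simpa [encodeWord, piece] using ih

theorem afterPiece_encodeWord (w : List Bool) (s : List Sym) :
    afterPiece (encodeWord w ++ s) = s := by
  induction w with
  | nil => rfl
  | cons b w ih => simpa [encodeWord, afterPiece] using ih

theorem encodeWord_injective : Function.Injective encodeWord := by
  intro w w' h
  have h' := List.append_cancel_right h
  exact List.map_injective_iff.2 (fun a b hab => by cases hab; rfl) h'

theorem pieceAt_encodeWords (ws : List (List Bool)) (s : List Sym) (k : ℕ) (hk : k < ws.length) :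
    pieceAt k ((ws.map encodeWord).flatten ++ s) = encodeWord ws[k] := by
  induction ws generalizing k with
  | nil => simp at hk
  | cons w ws ih =>
    cases k with
    | zero => simp [pieceAt, piece_encodeWord]
    | succ k =>
      simpa [pieceAt, afterPiece_encodeWord] using ih k (by simpa using hk)

theorem getLast?_cons_take (c : Sym) (s : List Sym) (p : ℕ) :
    ((c :: s).take (p + 1)).getLast? = (s.take p).getLast?.or (some c) := by
  rw [List.take_succ_cons, ← List.singleton_append, List.getLast?_append]
  rfl

theorem occursAfterWord_cons (c : Sym) (s : List Sym) (w : List Bool) :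
    OccursAfterWord (c :: s) w ↔ c = .endWord ∧ piece s = encodeWord w ∨ OccursAfterWord s w := by
  constructor
  · rintro ⟨p, hp, h₁, h₂⟩
    cases p with
    | zero => simp at h₁
    | succ p =>
      rw [getLast?_cons_take] at h₁
      cases p with
      | zero => exact Or.inl ⟨by simpa using h₁, h₂⟩
      | succ p =>
        refine Or.inr ⟨p + 1, by simpa using hp, ?_, h₂⟩
        have hs : s ≠ [] := by
          rintro rfl
          simp at hp
        obtain ⟨d, s, rfl⟩ := List.exists_cons_of_ne_nil hs
        rw [getLast?_cons_take] at h₁ ⊢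
        simpa using h₁
  · rintro (⟨rfl, h⟩ | ⟨p, hp, h₁, h₂⟩)
    · refine ⟨1, ?_, rfl, h⟩
      cases s with
      | nil => simp [piece, encodeWord] at h
      | cons d s => simp
    · exact ⟨p + 1, by simpa using hp, by rw [getLast?_cons_take, h₁]; rfl, h₂⟩

theorem occursAfterWord_encodeWord (v : List Bool) (s : List Sym) (w : List Bool) :
    OccursAfterWord (encodeWord v ++ s) w ↔ piece s = encodeWord w ∨ OccursAfterWord s w := by
  induction v with
  | nil => simp [encodeWord, occursAfterWord_cons]
  | cons b v ih =>
    rw [← ih]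
    simp [encodeWord, occursAfterWord_cons]

/-- Within a fact, each constant name follows an `endWord`, whereas the relation name `v` does not.
This is how constants are told apart from relation names. What follows the last `endWord` is the
delimiter of the fact, which is not a word. -/
theorem occursAfterWord_encodeWords (v : List Bool) (ws : List (List Bool)) (s : List Sym)
    (w : List Bool) :
    OccursAfterWord (encodeWord v ++ ((ws.map encodeWord).flatten ++ .endFact :: s)) w ↔
      w ∈ ws ∨ OccursAfterWord s w := by
  induction ws generalizing v with
  | nil =>
    have h : piece (.endFact :: s) ≠ encodeWord w := by
      cases w <;> simp [piece, encodeWord]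
    simp [occursAfterWord_encodeWord, occursAfterWord_cons, h]
  | cons u ws ih =>
    rw [occursAfterWord_encodeWord, List.map_cons, List.flatten_cons, List.append_assoc, ih,
      piece_encodeWord, encodeWord_injective.eq_iff, List.mem_cons, or_assoc, eq_comm]

theorem isStart_append {u s : List Sym} (hu : Sym.endFact ∉ u) (p : ℕ) :
    p < (u ++ .endFact :: s).length ∧ IsStart (u ++ .endFact :: s) p ↔
      p = 0 ∨ ∃ p', p = u.length + 1 + p' ∧ p' < s.length ∧ IsStart s p' := by
  have e : u ++ Sym.endFact :: s = (u ++ [Sym.endFact]) ++ s := by simp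
  rw [e]
  rcases Nat.lt_or_ge p (u.length + 1) with hp | hp
  · have h : ¬ ∃ p', p = u.length + 1 + p' ∧ p' < s.length ∧ IsStart s p' := by
      rintro ⟨p', rfl, _⟩
      omega
    rw [or_iff_left h, IsStart, List.take_append_of_le_length (by simp; omega),
      List.take_append_of_le_length (by omega)]
    constructor
    · rintro ⟨_, h | h⟩
      · rw [List.getLast?_eq_none_iff, List.take_eq_nil_iff] at h
        rcases h with h | rfl
        · exact h
        · simpa using hp
      · exact absurd (List.mem_of_mem_take (List.mem_of_getLast? h)) hu
    · rintro rfl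
      simp
  · obtain ⟨p', rfl⟩ := Nat.exists_eq_add_of_le hp
    have h₁ : (u ++ [Sym.endFact] ++ s).take (u.length + 1 + p')
        = u ++ [Sym.endFact] ++ s.take p' := by
      have : u.length + 1 + p' = (u ++ [Sym.endFact]).length + p' := by simp
      rw [this, List.take_length_add_append]
    rw [or_iff_right (by omega), IsStart, h₁, List.getLast?_append, List.getLast?_concat]
    simp only [List.length_append, List.length_singleton, add_lt_add_iff_left,
      Nat.add_left_cancel_iff, exists_eq_left', IsStart, Option.or_eq_none_iff,
      Option.or_eq_some_iff, reduceCtorEq, and_false, false_or]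
    tauto

variable {σ : Schema} {Const : Type} (relName : σ.Rel ↪ List Bool) (constName : Const ↪ List Bool)

/-- The encoding of a list of facts. -/
def encodeFacts (T : List (Fact σ Const)) : List Sym :=
  (T.map (encodeFact relName constName)).flatten

/-- The words of which a fact consists. -/
def argWords (f : Fact σ Const) : List (List Bool) :=
  List.ofFn fun i => constName (f.args i)

theorem encodeFact_append (f : Fact σ Const) (s : List Sym) :
    encodeFact relName constName f ++ s = encodeWord (relName f.rel) ++
      (((argWords constName f).map encodeWord).flatten ++ .endFact :: s) := by
  simp [encodeFact, argWords, List.map_ofFn, Function.comp_def]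

/-- The fact `f` of the list `T` begins at the position `p` of the encoding of `T`. -/
def FactAt (T : List (Fact σ Const)) (p : ℕ) (f : Fact σ Const) : Prop :=
  ∃ T₁ T₂, T = T₁ ++ f :: T₂ ∧ p = (encodeFacts relName constName T₁).length

theorem endFact_notMem_encodeWord (w : List Bool) : Sym.endFact ∉ encodeWord w := by
  simp [encodeWord]

/-- The symbol `endFact` occurs only at the end of a fact. The bound on p excludes the position
behind the last fact. -/
theorem isStart_iff (T : List (Fact σ Const)) (p : ℕ) :
    p < (encodeFacts relName constName T).length ∧ IsStart (encodeFacts relName constName T) p ↔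
      ∃ f, FactAt relName constName T p f := by
  induction T generalizing p with
  | nil => simp [encodeFacts, FactAt]
  | cons f T ih =>
    have h₁ : Sym.endFact ∉ encodeWord (relName f.rel) ++
        ((argWords constName f).map encodeWord).flatten := by
      simp [endFact_notMem_encodeWord]
    have h₂ : encodeFacts relName constName (f :: T) = encodeWord (relName f.rel) ++
        ((argWords constName f).map encodeWord).flatten ++
          .endFact :: encodeFacts relName constName T := by
      rw [encodeFacts, List.map_cons, List.flatten_cons, encodeFact_append, List.append_assoc]
      rfl
    have h₃ : (encodeWord (relName f.rel) ++
        ((argWords constName f).map encodeWord).flatten).length + 1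
          = (encodeFact relName constName f).length := by
      have := congrArg List.length (encodeFact_append relName constName f [])
      simp only [List.append_nil] at this
      rw [this]
      simp
      omega
    rw [h₂, isStart_append h₁, h₃]
    simp only [ih]
    constructor
    · rintro (rfl | ⟨p', rfl, g, T₁, T₂, rfl, rfl⟩)
      · exact ⟨f, [], T, rfl, rfl⟩
      · exact ⟨g, f :: T₁, T₂, rfl, by simp [encodeFacts]⟩
    · rintro ⟨g, T₁, T₂, h, rfl⟩
      cases T₁ with
      | nil => exact Or.inl rfl
      | cons f' T₁ =>
        obtain ⟨rfl, rfl⟩ := List.cons.inj h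
        exact Or.inr ⟨_, by simp [encodeFacts], g, T₁, T₂, rfl, rfl⟩

variable {relName constName}

theorem FactAt.mem {T : List (Fact σ Const)} {p : ℕ} {f : Fact σ Const}
    (h : FactAt relName constName T p f) : f ∈ T := by
  obtain ⟨T₁, T₂, rfl, _⟩ := h
  simp

theorem exists_factAt {T : List (Fact σ Const)} {f : Fact σ Const} (h : f ∈ T) :
    ∃ p, FactAt relName constName T p f := by
  obtain ⟨T₁, T₂, rfl⟩ := List.append_of_mem h
  exact ⟨_, T₁, T₂, rfl, rfl⟩

theorem FactAt.drop {T : List (Fact σ Const)} {p : ℕ} {f : Fact σ Const}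
    (h : FactAt relName constName T p f) :
    ∃ s, (encodeFacts relName constName T).drop p = encodeFact relName constName f ++ s := by
  obtain ⟨T₁, T₂, rfl, rfl⟩ := h
  exact ⟨encodeFacts relName constName T₂, by simp [encodeFacts]⟩

theorem length_encodeFact_pos (f : Fact σ Const) : 0 < (encodeFact relName constName f).length := by
  simp [encodeFact]

theorem encodeFacts_length_lt {T₁ T₂ : List (Fact σ Const)} {f : Fact σ Const}
    (h : T₁ ++ [f] <+: T₂) : (encodeFacts relName constName T₁).length
      < (encodeFacts relName constName T₂).length := by
  obtain ⟨T, rfl⟩ := h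
  have := length_encodeFact_pos (relName := relName) (constName := constName) f
  simp [encodeFacts] at this ⊢
  omega

/-- Facts have nonempty encodings, so different prefixes of T have encodings of different lengths.
-/
theorem FactAt.unique {T : List (Fact σ Const)} {p : ℕ} {f g : Fact σ Const}
    (hf : FactAt relName constName T p f) (hg : FactAt relName constName T p g) : f = g := by
  obtain ⟨T₁, T₂, h₁, hp⟩ := hf
  obtain ⟨T₁', T₂', h₁', hp'⟩ := hg
  have hlen : T₁.length = T₁'.length := by
    by_contra hne
    rcases Nat.lt_or_gt_of_ne hne with hlt | hlt
    · refine absurd (hp.symm.trans hp') (encodeFacts_length_lt (f := f) ?_).ne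
      refine List.prefix_of_prefix_length_le (l₃ := T) ⟨T₂, by simp [h₁]⟩ ⟨g :: T₂', h₁'.symm⟩ ?_
      simpa using hlt
    · refine absurd (hp'.symm.trans hp) (encodeFacts_length_lt (f := g) ?_).ne
      refine List.prefix_of_prefix_length_le (l₃ := T) ⟨T₂', by simp [h₁']⟩ ⟨f :: T₂, h₁.symm⟩ ?_
      simpa using hlt
  have := List.append_inj_right (h₁.symm.trans h₁') hlen
  exact (List.cons.inj this).1

/-- In an input, the distinguished fact g occurs both in front and within the list T. Every other
fact has only one position. -/
theorem FactAt.position_unique {T : List (Fact σ Const)} {p p' : ℕ} {f g : Fact σ Const}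
    (hT : T.Nodup) (hne : f ≠ g) (h : FactAt relName constName (g :: T) p f)
    (h' : FactAt relName constName (g :: T) p' f) : p = p' := by
  obtain ⟨T₁, T₂, h₁, rfl⟩ := h
  obtain ⟨T₁', T₂', h₁', rfl⟩ := h'
  cases T₁ with
  | nil => exact absurd (List.cons.inj h₁).1.symm hne
  | cons g₁ T₁ =>
    cases T₁' with
    | nil => exact absurd (List.cons.inj h₁').1.symm hne
    | cons g₁' T₁' =>
      obtain ⟨rfl, e⟩ := List.cons.inj h₁
      obtain ⟨rfl, e'⟩ := List.cons.inj h₁'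
      change T = T₁ ++ f :: T₂ at e
      change T = T₁' ++ f :: T₂' at e'
      have hT₁ : f ∉ T₁ := by
        intro hf
        rw [e, List.nodup_append] at hT
        exact hT.2.2 _ hf _ (by simp) rfl
      have hT₂ : f ∉ T₂ := by
        intro hf
        rw [e, List.nodup_append, List.nodup_cons] at hT
        exact hT.2.1.1 hf
      rw [(List.append_cons_inj_of_notMem hT₁ hT₂).1 (e.symm.trans e') |>.1]

theorem occursAfterWord_encodeFacts (T : List (Fact σ Const)) (w : List Bool) :
    OccursAfterWord (encodeFacts relName constName T) w ↔
      ∃ f ∈ T, ∃ i, constName (f.args i) = w := by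
  induction T with
  | nil => simp [encodeFacts, OccursAfterWord]
  | cons f T ih =>
    have h : encodeFacts relName constName (f :: T) = encodeFact relName constName f ++
        encodeFacts relName constName T := rfl
    rw [h, encodeFact_append, occursAfterWord_encodeWords, ih]
    simp [argWords, List.mem_ofFn]

theorem pieceAt_zero_encodeFact (f : Fact σ Const) (s : List Sym) :
    pieceAt 0 (encodeFact relName constName f ++ s) = encodeWord (relName f.rel) := by
  rw [encodeFact_append]
  exact piece_encodeWord _ _

theorem pieceAt_succ_encodeFact (f : Fact σ Const) (s : List Sym) (i : Fin (σ.arity f.rel)) :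
    pieceAt (i + 1) (encodeFact relName constName f ++ s) = encodeWord (constName (f.args i)) := by
  have h := pieceAt_encodeWords (argWords constName f) (.endFact :: s) i (by simp [argWords])
  rw [encodeFact_append, pieceAt, Function.iterate_succ_apply, afterPiece_encodeWord]
  rw [pieceAt] at h
  rw [h]
  simp [argWords]

/-- Names are injective, and once the relation names agree so do the arities; hence the arity of g
tells how many pieces to compare. -/
theorem eq_iff_pieceAt (f g : Fact σ Const) (s : List Sym) :
    f = g ↔ pieceAt 0 (encodeFact relName constName f ++ s) = encodeWord (relName g.rel) ∧
      ∀ i : Fin (σ.arity g.rel), pieceAt (i + 1) (encodeFact relName constName f ++ s)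
        = encodeWord (constName (g.args i)) := by
  constructor
  · rintro rfl
    exact ⟨pieceAt_zero_encodeFact f s, pieceAt_succ_encodeFact f s⟩
  · rintro ⟨h₁, h₂⟩
    rw [pieceAt_zero_encodeFact] at h₁
    have h := relName.injective (encodeWord_injective h₁)
    obtain ⟨R, a⟩ := f
    obtain ⟨R', a'⟩ := g
    obtain rfl : R = R' := h
    congr 1
    funext i
    have := h₂ i
    rw [pieceAt_succ_encodeFact (f := ⟨R, a⟩)] at this
    exact constName.injective (encodeWord_injective this)

/-- Used to read off a valuation from the facts at the pointers. -/
theorem exists_const_of_pieceAt {f : Fact σ Const} {s : List Sym} {R : σ.Rel}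
    (h : pieceAt 0 (encodeFact relName constName f ++ s) = encodeWord (relName R))
    (i : Fin (σ.arity R)) :
    ∃ c, pieceAt (i + 1) (encodeFact relName constName f ++ s) = encodeWord (constName c) := by
  rw [pieceAt_zero_encodeFact] at h
  obtain rfl := relName.injective (encodeWord_injective h)
  exact ⟨_, pieceAt_succ_encodeFact f s i⟩

end DB

/-! ### Testing with pointers whether facts form a positive support. -/

namespace DB

open Prog Function

variable {σ : Schema} {Const : Type} {Var : Type*} (relName : σ.Rel ↪ List Bool)
  (constName : Const ↪ List Bool) {ι : Type}

/-- The variable `y` occurs in a positive atom. -/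
def CQNeg.Binds (p : CQNeg σ Const Var) (y : Var) : Prop :=
  ∃ u : Fin p.pos.length, (p.pos.get u).HasVar y

theorem CQNeg.binds_iff {p : CQNeg σ Const Var} {y : Var} :
    p.Binds y ↔ ∃ b ∈ p.pos, b.HasVar y := by
  constructor
  · rintro ⟨u, hu⟩
    exact ⟨_, p.pos.get_mem u, hu⟩
  · rintro ⟨b, hb, hy⟩
    obtain ⟨u, rfl⟩ := List.get_of_mem hb
    exact ⟨u, hy⟩

open scoped Classical in
/-- Where the value of a term can be found, if the positive atom with number `u` is mapped to the
fact at the pointer `h u`. -/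
noncomputable def CQNeg.ref (p : CQNeg σ Const Var) (h : Fin p.pos.length → ι) :
    Term Const Var → Ref ι
  | .const c => .word (encodeWord (constName c))
  | .var y => if H : p.Binds y then .piece (h H.choose) (H.choose_spec.choose + 1) else .word []

/-- The fact at the pointer `i` is an instance of the atom `a`. -/
def CQNeg.MatchesAt (p : CQNeg σ Const Var) (h : Fin p.pos.length → ι) (i : ι)
    (a : Atom σ (Term Const Var)) (s : List Sym) (x : ι → ℕ) : Prop :=
  (Ref.piece i 0).val s x = (Ref.word (encodeWord (relName a.rel)) : Ref ι).val s x ∧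
    ∀ j : Fin (σ.arity a.rel),
      (Ref.piece i (j + 1)).val s x = (p.ref constName h (a.args j)).val s x

variable {constName} in
theorem CQNeg.ref_var_val {p : CQNeg σ Const Var} {h : Fin p.pos.length → ι}
    {y : Var} (hy : p.Binds y) :
    ∃ (u : Fin p.pos.length) (i : Fin (σ.arity (p.pos.get u).rel)),
      (p.pos.get u).args i = .var y ∧
        p.ref constName h (.var y) = .piece (h u) (i + 1) :=
  ⟨hy.choose, hy.choose_spec.choose, hy.choose_spec.choose_spec, dif_pos hy⟩

/-- The values of all variables are those given by `ν`. -/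
def CQNeg.Compatible (p : CQNeg σ Const Var)
    (h : Fin p.pos.length → ι) (s : List Sym) (x : ι → ℕ) (ν : Var → Const) : Prop :=
  ∀ y, p.Binds y → (p.ref constName h (.var y)).val s x = encodeWord (constName (ν y))

variable {constName} in
theorem CQNeg.Compatible.ref_val {p : CQNeg σ Const Var} {h : Fin p.pos.length → ι}
    {s : List Sym} {x : ι → ℕ} {ν : Var → Const} (hν : p.Compatible constName h s x ν)
    (t : Term Const Var) (ht : ∀ y, t = .var y → p.Binds y) :
    (p.ref constName h t).val s x = encodeWord (constName (t.eval ν)) := by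
  cases t with
  | const c => rfl
  | var y => exact hν y (ht y rfl)

variable {relName constName} in
theorem CQNeg.Compatible.matchesAt_iff {p : CQNeg σ Const Var} {h : Fin p.pos.length → ι}
    {s : List Sym} {x : ι → ℕ} {ν : Var → Const} (hν : p.Compatible constName h s x ν)
    {i : ι} {f : Fact σ Const} {r : List Sym}
    (hf : s.drop (x i) = encodeFact relName constName f ++ r) {a : Atom σ (Term Const Var)}
    (ha : ∀ y, a.HasVar y → p.Binds y) :
    p.MatchesAt relName constName h i a s x ↔ f = a.map (Term.eval ν) := by
  rw [eq_iff_pieceAt (relName := relName) (constName := constName) f _ r, ← hf]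
  refine and_congr Iff.rfl (forall_congr' fun j => ?_)
  rw [hν.ref_val _ fun y hy => ha y ⟨j, hy⟩]
  rfl

variable [DecidableEq ι]

/-- The facts at the pointers `h u` witness that `p` is satisfied. -/
def CQNeg.Witnessed (scr : ι) (p : CQNeg σ Const Var) (h : Fin p.pos.length → ι) (s : List Sym)
    (x : ι → ℕ) : Prop :=
  (∀ u, p.MatchesAt relName constName h (h u) (p.pos.get u) s x) ∧
  (∀ a ∈ {a | a ∈ p.neg}, (∀ j : Fin (σ.arity a.rel), ∀ c ∈ {c | a.args j = .const c},
      OccursAfterWord s (constName c)) ∧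
    ¬ ∃ k < s.length, IsStart s (update x scr k scr) ∧
      p.MatchesAt relName constName h scr a s (update x scr k)) ∧
  ∀ e ∈ {e | e ∈ p.ineq}, ¬ (p.ref constName h e.1).val s x = (p.ref constName h e.2).val s x

/-- The facts at the pointers in `J` form a positive support. -/
def SupportedBy (scr : ι) (q : UCQNeg σ Const Var) (J : Finset ι) (s : List Sym) (x : ι → ℕ) :
    Prop :=
  ∃ p ∈ {p | p ∈ q}, ∃ h : Fin p.pos.length → J,
    p.Witnessed relName constName scr (fun u => h u) s x

section Decidability

variable {C : (ι → ℕ) → Prop}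

theorem dec_isStart (i : ι) : Dec C fun s x => IsStart s (x i) :=
  (dec_previous i fun o => decide (o = none ∨ o = some .endFact)).congr fun s x _ => by
    simp [IsStart]

theorem dec_occursAfterWord (scr : ι) (hC : ∀ x, C x → x scr = 0) (w : List Bool) :
    Dec C fun s _ => OccursAfterWord s w := by
  have h : Dec (fun _ => True) fun s (x : ι → ℕ) =>
      decide ((s.take (x scr)).getLast? = some .endWord) = true ∧
        (Ref.piece scr 0).val s x = (Ref.word (encodeWord w) : Ref ι).val s x :=
    (dec_previous scr fun o => decide (o = some .endWord)).and (dec_eq _ _)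
  exact (h.exists_position hC fun _ _ _ => trivial).congr fun s x _ => by
    simp [OccursAfterWord, Ref.val]

variable {relName constName} in
theorem dec_matchesAt (p : CQNeg σ Const Var) (h : Fin p.pos.length → ι) (i : ι)
    (a : Atom σ (Term Const Var)) : Dec C (p.MatchesAt relName constName h i a) :=
  (dec_eq _ _).and (Dec.forall fun _ => dec_eq _ _)

/-- All quantifiers range over parts of the fixed query or over assignments of its atoms to
pointers, except for the loops of the scratch pointer over the input. -/
theorem dec_supportedBy (scr : ι) (hC : ∀ x, C x → x scr = 0) (q : UCQNeg σ Const Var)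
    (J : Finset ι) : Dec C (SupportedBy relName constName scr q J) := by
  refine Dec.exists_mem (List.finite_toSet q) fun p _ => Dec.exists fun h => ?_
  refine (Dec.forall fun u => dec_matchesAt p _ _ _).and
    ((Dec.forall_mem (List.finite_toSet p.neg) fun a _ => ?_).and
      (Dec.forall_mem (List.finite_toSet p.ineq) fun e _ => (dec_eq _ _).not))
  refine (Dec.forall fun j => Dec.forall_mem ?_ fun c _ => dec_occursAfterWord scr hC _).and
    (((dec_isStart scr).and (dec_matchesAt p _ _ _)).exists_position (C := fun _ => True) hC
      fun _ _ _ => trivial).not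
  -- An argument of the atom is at most one constant, so the quantifier over c is finite although
  -- `Const` may be infinite.
  refine Set.Subsingleton.finite fun c hc c' hc' => ?_
  have := hc.symm.trans hc'
  exact Term.const.inj this

end Decidability

section Correctness

variable {relName constName} {p : CQNeg σ Const Var} {h : Fin p.pos.length → ι} {s : List Sym}
  {x : ι → ℕ} {T : List (Fact σ Const)} {D : Finset (Fact σ Const)} {scr : ι}

/-- Values of variables are read only at the pointers `h u`, so the scratch pointer can roam freely.
-/
theorem CQNeg.compatible_update (hscr : ∀ u, h u ≠ scr) {ν : Var → Const} (k : ℕ)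
    (hν : p.Compatible constName h s x ν) :
    p.Compatible constName h s (update x scr k) ν := by
  intro y hy
  rw [← hν y hy]
  obtain ⟨u, i, _, e⟩ := CQNeg.ref_var_val (constName := constName) (h := h) hy
  rw [e]
  simp [Ref.val, hscr u]

theorem CQNeg.binds_of_neg {a : Atom σ (Term Const Var)} (ha : a ∈ p.neg) (y : Var)
    (hy : a.HasVar y) : p.Binds y :=
  CQNeg.binds_iff.2 (p.safe_neg a ha y hy)

theorem CQNeg.binds_of_ineq {e : Term Const Var × Term Const Var} (he : e ∈ p.ineq) (y : Var)
    (hy : e.1 = .var y ∨ e.2 = .var y) : p.Binds y :=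
  CQNeg.binds_iff.2 (p.safe_ineq e he y hy)

/-- Once the words that are read are the names of the values of ν, each comparison of words is one
of constants or facts. -/
theorem CQNeg.witnessed_iff_of_compatible (hscr : ∀ u, h u ≠ scr) (hD : ∀ f, f ∈ D ↔ f ∈ T)
    {F : ι → Fact σ Const} (hF : ∀ u, FactAt relName constName T (x (h u)) (F (h u)))
    {ν : Var → Const} (hν : p.Compatible constName h (encodeFacts relName constName T) x ν) :
    p.Witnessed relName constName scr h (encodeFacts relName constName T) x ↔
      (∀ u, F (h u) = (p.pos.get u).map (Term.eval ν)) ∧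
      (∀ a ∈ p.neg, a.map (Term.eval ν) ∈ negFacts D) ∧
      ∀ e ∈ p.ineq, e.1.eval ν ≠ e.2.eval ν := by
  have hpos (u : Fin p.pos.length) :
      p.MatchesAt relName constName h (h u) (p.pos.get u) (encodeFacts relName constName T) x ↔
        F (h u) = (p.pos.get u).map (Term.eval ν) := by
    obtain ⟨r, hr⟩ := (hF u).drop
    exact hν.matchesAt_iff hr fun y hy => ⟨u, hy⟩
  have hineq : (∀ e ∈ {e | e ∈ p.ineq},
      ¬ (p.ref constName h e.1).val (encodeFacts relName constName T) x
        = (p.ref constName h e.2).val (encodeFacts relName constName T) x) ↔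
      ∀ e ∈ p.ineq, e.1.eval ν ≠ e.2.eval ν := by
    refine forall₂_congr fun e he => not_congr ?_
    rw [hν.ref_val e.1 fun y hy => CQNeg.binds_of_ineq he y (Or.inl hy),
      hν.ref_val e.2 fun y hy => CQNeg.binds_of_ineq he y (Or.inr hy),
      encodeWord_injective.eq_iff, constName.injective.eq_iff]
  refine (and_congr (forall_congr' hpos) (and_congr_right' hineq)).trans ?_
  refine and_congr_right fun hu => and_congr_left' (forall₂_congr fun a ha => and_congr ?_ ?_)
  · refine forall_congr' fun j => ?_
    simp only [occursAfterWord_encodeFacts, activeDomain, Set.mem_ofPred_eq, hD,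
      constName.injective.eq_iff]
    constructor
    · intro hj
      cases hc : a.args j with
      | const c => simpa [Atom.map, hc, Term.eval] using hj c hc
      | var y =>
        -- By safety, the value of a variable occurs in a fact of D, which is why the program checks
        -- only the constants of a negated atom against the active domain.
        obtain ⟨u, i, hi⟩ := CQNeg.binds_of_neg ha y ⟨j, hc⟩
        have hmem := (hF u).mem
        rw [hu u] at hmem
        exact ⟨_, hmem, i, congrArg (Term.eval ν) (hi.trans hc.symm)⟩
    · intro hj c hc
      simpa [Atom.map, show a.args j = .const c from hc, Term.eval] using hj
  · rw [hD]
    refine not_congr ?_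
    constructor
    · rintro ⟨k, hk, h₁, h₂⟩
      rw [update_self] at h₁
      obtain ⟨f, hf⟩ := (isStart_iff relName constName T k).1 ⟨hk, h₁⟩
      obtain ⟨r, hr⟩ := hf.drop
      rw [(CQNeg.compatible_update hscr k hν).matchesAt_iff (f := f) (r := r)
        (by rw [update_self, hr]) (CQNeg.binds_of_neg ha)] at h₂
      exact h₂ ▸ hf.mem
    · intro hmem
      obtain ⟨k, hk⟩ := exists_factAt (relName := relName) (constName := constName) hmem
      obtain ⟨h₀, h₁⟩ := (isStart_iff relName constName T k).2 ⟨_, hk⟩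
      obtain ⟨r, hr⟩ := hk.drop
      refine ⟨k, h₀, by rwa [update_self], ?_⟩
      rw [(CQNeg.compatible_update hscr k hν).matchesAt_iff (r := r)
        (by rw [update_self, hr]) (CQNeg.binds_of_neg ha)]

/-- The valuation need not be searched for: each bound variable takes the constant at its chosen
occurrence in a positive atom. An arbitrary constant serves the unbound variables, which occur
nowhere in the disjunct's positive or negated atoms or inequalities. -/
theorem CQNeg.witnessed_iff [Nonempty Const] (hscr : ∀ u, h u ≠ scr) (hD : ∀ f, f ∈ D ↔ f ∈ T)
    {F : ι → Fact σ Const} (hF : ∀ u, FactAt relName constName T (x (h u)) (F (h u))) :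
    p.Witnessed relName constName scr h (encodeFacts relName constName T) x ↔ ∃ ν : Var → Const,
      (∀ u, F (h u) = (p.pos.get u).map (Term.eval ν)) ∧
      (∀ a ∈ p.neg, a.map (Term.eval ν) ∈ negFacts D) ∧
      ∀ e ∈ p.ineq, e.1.eval ν ≠ e.2.eval ν := by
  constructor
  · intro hw
    have hval (y : Var) : ∃ c, p.Binds y →
        (p.ref constName h (.var y)).val (encodeFacts relName constName T) x
          = encodeWord (constName c) := by
      by_cases hy : p.Binds y
      · obtain ⟨u, i, _, e⟩ := CQNeg.ref_var_val (constName := constName) (h := h) hy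
        obtain ⟨r, hr⟩ := (hF u).drop
        have h₀ := (hw.1 u).1
        simp only [Ref.val, hr] at h₀
        obtain ⟨c, hc⟩ := exists_const_of_pieceAt h₀ i
        refine ⟨c, fun _ => ?_⟩
        rw [e, ← hc, ← hr]
        rfl
      · exact ⟨Classical.arbitrary _, fun h => absurd h hy⟩
    choose ν hν using hval
    exact ⟨ν, (CQNeg.witnessed_iff_of_compatible hscr hD hF hν).1 hw⟩
  · rintro ⟨ν, hw⟩
    refine (CQNeg.witnessed_iff_of_compatible hscr hD hF fun y hy => ?_).2 hw
    obtain ⟨u, i, hi, e⟩ := CQNeg.ref_var_val (constName := constName) (h := h) hy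
    obtain ⟨r, hr⟩ := (hF u).drop
    have := ((eq_iff_pieceAt (relName := relName) (constName := constName) _ _ r).1 (hw.1 u)).2 i
    rw [← hr] at this
    rw [e]
    refine this.trans ?_
    simp only [Atom.map, hi, Term.eval]

/-- The assignment h of atoms to pointers is arbitrary: several atoms may share a fact, and some
facts may remain unused. The scratch pointer must lie outside J, for it moves during the test. -/
theorem supportedBy_iff [DecidableEq (Fact σ Const)] [Nonempty Const] {q : UCQNeg σ Const Var}
    (hD : ∀ f, f ∈ D ↔ f ∈ T) {J : Finset ι} (hJ : scr ∉ J)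
    {F : ι → Fact σ Const} (hF : ∀ i ∈ J, FactAt relName constName T (x i) (F i)) :
    SupportedBy relName constName scr q J (encodeFacts relName constName T) x ↔
      IsPositiveSupport q D (J.image F) := by
  have hsub : J.image F ⊆ D := by
    intro f hf
    obtain ⟨i, hi, rfl⟩ := Finset.mem_image.1 hf
    exact (hD _).2 (hF i hi).mem
  rw [isPositiveSupport_iff, and_iff_right hsub]
  refine exists_congr fun p => and_congr Iff.rfl ?_
  have hw (h : Fin p.pos.length → J) := CQNeg.witnessed_iff (relName := relName)
    (constName := constName) (p := p) (h := fun u => (h u : ι)) (x := x) (scr := scr)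
    (fun u hu => hJ (hu ▸ (h u).2)) hD (F := F) fun u => hF _ (h u).2
  simp only [hw]
  constructor
  · rintro ⟨h, ν, h₁, h₂⟩
    refine ⟨ν, fun a ha => ?_, h₂⟩
    obtain ⟨u, rfl⟩ := List.get_of_mem ha
    rw [← h₁ u]
    exact Finset.mem_image_of_mem F (h u).2
  · rintro ⟨ν, h₁, h₂⟩
    have (u : Fin p.pos.length) : ∃ i : J, F i = (p.pos.get u).map (Term.eval ν) := by
      obtain ⟨i, hi, e⟩ := Finset.mem_image.1 (h₁ _ (p.pos.get_mem u))
      exact ⟨⟨i, hi⟩, e⟩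
    choose h hh using this
    exact ⟨h, ν, hh, h₂⟩

end Correctness

end DB

/-! ### Counting critical tuples and computing the numerator. -/

namespace DB

open Prog Function Finset

section Counting

variable {K m : ℕ}

/-- Move the pointers `0, …, m - 1` to the positions `y`. -/
def place (x : Bool ⊕ Fin K → ℕ) (y : Fin m → ℕ) : Bool ⊕ Fin K → ℕ
  | .inl b => x (.inl b)
  | .inr j => if h : j.1 < m then y ⟨j, h⟩ else x (.inr j)

/-- The auxiliary pointer and the pointers from `m` on are at the beginning of the input. -/
def AtStart (m : ℕ) (x : Bool ⊕ Fin K → ℕ) : Prop :=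
  x (.inl false) = 0 ∧ ∀ j : Fin K, m ≤ j → x (.inr j) = 0

/-- A nest of m loops, one per pointer, with the loop of the last pointer innermost. Each loop needs
its pointer at 0 when it is entered, which `AtStart` records. -/
theorem cnt_sum_place : ∀ (m : ℕ) {N : List Sym → (Bool ⊕ Fin K → ℕ) → ℕ}, m ≤ K →
    Cnt (AtStart m) N → Cnt (AtStart 0) fun s x =>
      ∑ y : Fin m → Fin s.length, N s (place x fun j => (y j : ℕ))
  | 0, N, _, h => by
    refine h.congr fun s x _ => ?_
    rw [Fintype.sum_unique]
    congr 1
    funext i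
    cases i <;> simp [place]
  | m + 1, N, hm, h => by
    have h' : Cnt (AtStart m) fun s x => ∑ k ∈ range s.length,
        N s (update x (.inr ⟨m, hm⟩) k) := by
      refine h.sum_positions (fun x hx => hx.2 _ le_rfl) fun x k hx => ⟨by simpa using hx.1, ?_⟩
      intro j hj
      rw [update_of_ne]
      · exact hx.2 j (by omega)
      · intro e
        have := congrArg Fin.val (Sum.inr.inj e)
        simp at this
        omega
    refine (cnt_sum_place m (by omega) h').congr fun s x _ => ?_
    simp only [sum_range]
    rw [sum_comm, ← Fintype.sum_prod_type']
    -- A tuple of length m + 1 is its last entry together with the m entries before.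
    refine Fintype.sum_equiv (Fin.snocEquiv fun _ => Fin s.length) _ _ fun z => ?_
    congr 1
    funext i
    rcases i with b | j
    · simp [place]
    · rcases lt_trichotomy j.1 m with hj | hj | hj
      · have hne : j ≠ ⟨m, hm⟩ := fun e => by simp [e] at hj
        simp [place, hj, hne, Fin.snocEquiv, Fin.snoc, Nat.lt_succ_of_lt hj]
      · obtain rfl : j = ⟨m, hm⟩ := Fin.ext hj
        simp [place, Fin.snocEquiv, Fin.snoc]
      · have hne : j ≠ ⟨m, hm⟩ := fun e => by simp [e] at hj
        simp [place, hne, not_lt.2 hj.le, show ¬ j.1 < m + 1 by omega]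

variable {σ : Schema} {Const : Type} {Var : Type*} (relName : σ.Rel ↪ List Bool)
  (constName : Const ↪ List Bool) (q : UCQNeg σ Const Var)

/-- The pointer with number `j`. -/
abbrev pointer (hm : m ≤ K) (j : Fin m) : Bool ⊕ Fin K :=
  .inr (Fin.castLE hm j)

/-- The first `m` pointers are at facts that form a critical tuple, where the distinguished fact is
the one at the pointer `.inl true`. -/
def CriticalAt (hm : m ≤ K) (s : List Sym) (x : Bool ⊕ Fin K → ℕ) : Prop :=
  (∀ j, IsStart s (x (pointer hm j))) ∧
    SupportedBy relName constName (.inl false) q (insert (.inl true) (univ.image (pointer hm)))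
      s x ∧
    ¬ SupportedBy relName constName (.inl false) q (univ.image (pointer hm)) s x ∧
    ∀ j, ¬ SupportedBy relName constName (.inl false) q
      (insert (.inl true) ((univ.erase j).image (pointer hm))) s x

theorem dec_criticalAt (hm : m ≤ K) {C : (Bool ⊕ Fin K → ℕ) → Prop}
    (hC : ∀ x, C x → x (.inl false) = 0) : Dec C (CriticalAt relName constName q hm) :=
  (Dec.forall fun _ => dec_isStart _).and ((dec_supportedBy _ _ _ hC _ _).and
    ((dec_supportedBy _ _ _ hC _ _).not.and
      (Dec.forall fun _ => (dec_supportedBy _ _ _ hC _ _).not)))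

open scoped Classical in
/-- The numerator of the MPS-Shapley value, over the denominator `K !`. -/
noncomputable def numerator (K : ℕ) (s : List Sym) (x : Bool ⊕ Fin K → ℕ) : ℕ :=
  ∑ m : Fin K, ∑ y : Fin m → Fin s.length,
    if CriticalAt relName constName q m.2.le s (place x fun j => (y j : ℕ))
      then K.factorial / (m.1 + 1).factorial else 0

theorem cnt_numerator : Cnt (AtStart 0) (numerator relName constName q K) :=
  Cnt.sum univ fun m _ => cnt_sum_place m m.2.le
    (Cnt.ite (dec_criticalAt relName constName q m.2.le fun _ hx => hx.1) (Cnt.const _))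

end Counting

section Correctness

variable {K m : ℕ} {σ : Schema} {Const : Type} {Var : Type*} {relName : σ.Rel ↪ List Bool}
  {constName : Const ↪ List Bool} {q : UCQNeg σ Const Var} [DecidableEq (Fact σ Const)]
  [Nonempty Const] {D : Finset (Fact σ Const)} {T : List (Fact σ Const)} {α : Fact σ Const}

theorem criticalAt_iff (hD : ∀ f, f ∈ D ↔ f ∈ α :: T) (hm : m ≤ K) {y : Fin m → ℕ}
    {f : Fin m → Fact σ Const} (hf : ∀ j, FactAt relName constName (α :: T) (y j) (f j)) :
    CriticalAt relName constName q hm (encodeFacts relName constName (α :: T)) (place 0 y) ↔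
      Critical (IsPositiveSupport q D) α f := by
  -- The pointers outside the tuple stand at 0, where the encoding begins with α.
  let F : Bool ⊕ Fin K → Fact σ Const
    | .inl _ => α
    | .inr j => if h : j.1 < m then f ⟨j, h⟩ else α
  have hFp (j : Fin m) : F (pointer hm j) = f j := by simp [F]
  have hFat : ∀ i, i ≠ .inl false →
      FactAt relName constName (α :: T) (place 0 y i) (F i) := by
    intro i _
    have h₀ : FactAt relName constName (α :: T) 0 α := ⟨[], T, rfl, rfl⟩
    rcases i with b | j
    · exact h₀
    · by_cases hj : j.1 < m
      · simpa [place, F, hj] using hf ⟨j, hj⟩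
      · simpa [place, F, hj] using h₀
  have himg (A : Finset (Fin m)) : (A.image (pointer hm)).image F = A.image f := by
    rw [image_image]
    exact image_congr fun j _ => hFp j
  have hsup (J : Finset (Bool ⊕ Fin K)) (hJ : .inl false ∉ J) :
      SupportedBy relName constName (.inl false) q J (encodeFacts relName constName (α :: T))
        (place 0 y) ↔ IsPositiveSupport q D (J.image F) :=
    supportedBy_iff hD hJ fun i hi => hFat i fun e => hJ (e ▸ hi)
  rw [CriticalAt, Critical, hsup _ (by simp), hsup _ (by simp), image_insert, himg,
    and_iff_right fun j => ?_]
  · refine and_congr Iff.rfl (and_congr Iff.rfl (forall_congr' fun j => ?_))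
    rw [hsup _ (by simp), image_insert, himg]
  · have := ((isStart_iff relName constName (α :: T) _).2 ⟨_, hf j⟩).2
    simpa [place] using this

-- Tuples of facts correspond to tuples of their positions. The exception would be α, which can have
-- two positions, but a critical tuple avoids α.
open scoped Classical in
theorem card_criticalAt (hD : ∀ f, f ∈ D ↔ f ∈ α :: T) (hT : T.Nodup) (hm : m ≤ K) :
    #{y : Fin m → Fin (encodeFacts relName constName (α :: T)).length |
      CriticalAt relName constName q hm (encodeFacts relName constName (α :: T))
        (place 0 fun j => (y j : ℕ))}
      = #{y : Fin m → D | Critical (IsPositiveSupport q D) α fun j => (y j : Fact σ Const)} := by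
  have hαD : α ∈ D := (hD α).2 (by simp)
  have hpos (f : D) : ∃ p, FactAt relName constName (α :: T) p f :=
    exists_factAt ((hD f).1 f.2)
  choose pos hpos using hpos
  have hlt (f : D) : pos f < (encodeFacts relName constName (α :: T)).length :=
    ((isStart_iff relName constName (α :: T) _).2 ⟨_, hpos f⟩).1
  symm
  refine card_bij (fun y _ j => ⟨pos (y j), hlt (y j)⟩) ?_ ?_ ?_
  · intro y hy
    simp only [mem_filter, mem_univ, true_and] at hy ⊢
    exact (criticalAt_iff hD hm fun j => hpos (y j)).2 hy
  · intro y _ y' _ h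
    funext j
    have h₁ : pos (y j) = pos (y' j) := congrArg Fin.val (congrFun h j)
    exact Subtype.ext ((hpos (y j)).unique (h₁ ▸ hpos (y' j)))
  · intro y hy
    simp only [mem_filter, mem_univ, true_and] at hy
    have hf (j : Fin m) : ∃ f, FactAt relName constName (α :: T) (y j) f := by
      refine (isStart_iff relName constName (α :: T) _).1 ⟨(y j).2, ?_⟩
      simpa [place] using hy.1 j
    choose f hf using hf
    have hfD (j : Fin m) : f j ∈ D := (hD _).2 (hf j).mem
    have hcrit := (criticalAt_iff hD hm hf).1 hy
    have hne := ((critical_iff (D := D) (fun S S' h h' hS => hS.mono h h') hαD hfD).1 hcrit).2.1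
    refine ⟨fun j => ⟨f j, hfD j⟩, by simpa using hcrit, ?_⟩
    funext j
    exact Fin.ext ((hpos ⟨f j, hfD j⟩).position_unique hT (hne j) (hf j))

end Correctness

variable {σ : Schema} {Const : Type} {Var : Type*} {relName : σ.Rel ↪ List Bool}
  {constName : Const ↪ List Bool} {q : UCQNeg σ Const Var}

theorem encodeInput_eq (I : Input σ Const) :
    encodeInput relName constName I = encodeFacts relName constName (I.target :: I.facts) :=
  rfl

theorem mpsShapley_eq (I : Input σ Const) : mpsShapley q I.db I.fact
    = (numerator relName constName q q.width (encodeInput relName constName I) 0 : ℝ)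
      / q.width.factorial := by
  classical
  -- Positive arity provides a constant.
  have : Nonempty Const := ⟨I.target.args ⟨0, σ.arity_pos _⟩⟩
  have hD : ∀ f, f ∈ I.db ↔ f ∈ I.target :: I.facts := by
    intro f
    simp only [Input.db, List.mem_toFinset, List.mem_cons]
    exact ⟨Or.inr, fun h => h.elim (fun e => e ▸ I.target_mem) id⟩
  have hα : I.target ∈ I.db := (hD _).2 (by simp)
  have h₁ : mpsShapley q I.db I.fact = ∑ S ∈ I.db.powerset with
      Minimal (IsPositiveSupport q I.db) S ∧ I.target ∈ S, (1 : ℝ) / #S := by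
    have h := shapley_card I.db (IsMinimalPositiveSupport q I.db) I.fact
    convert! h
  rw [h₁, sum_minimal (fun S T h h' hS => hS.mono h h') hα
    (fun S hS => IsMinimalPositiveSupport.card_le hS), numerator, sum_range]
  congr 2
  refine sum_congr rfl fun m _ => ?_
  rw [← sum_filter, sum_const, smul_eq_mul, mul_comm, encodeInput_eq]
  congr 1
  exact (card_criticalAt hD I.nodup m.2.le).symm

end DB

/-! ### Assembling the machine. -/

theorem mainTheorem2 (σ : DB.Schema) (Const : Type) (Var : Type*)
    (relName : σ.Rel ↪ List Bool) (constName : Const ↪ List Bool)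
    (q : DB.UCQNeg σ Const Var) :
    ∃ f : DB.Input σ Const → ℚ,
      (∀ I : DB.Input σ Const, (f I : ℝ) = DB.mpsShapley q I.db I.fact) ∧
      Nonempty (Turing.TM2ComputableInPolyTime
        (DB.encodeInput relName constName) DB.encodeRat f) := by
  refine ⟨fun I => (DB.numerator relName constName q q.width
    (DB.encodeInput relName constName I) 0 : ℚ) / q.width.factorial, fun I => ?_, ?_⟩
  · rw [DB.mpsShapley_eq (relName := relName) (constName := constName)]
    push_cast
    rfl
  obtain ⟨p, t, hp⟩ := DB.cnt_numerator (K := q.width) relName constName q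
  obtain ⟨t', ht'⟩ := DB.Prog.runs_writeOutput (ι := Bool ⊕ Fin q.width) (fun _ => []) (fun _ => [])
    [] q.width.factorial (Nat.factorial_pos _)
  let c : ℕ := Fintype.card (Bool ⊕ Fin q.width)
  refine DB.Prog.computable (.seq (DB.Prog.setup (.inl true)) (.seq p (.seq DB.Prog.cleanup
    (DB.Prog.writeOutput q.width.factorial)))) (.right (.inl true)) .out _ _ _
    (((c + 4 : ℕ) : Polynomial ℕ) * (Polynomial.X + 1) + (t + ((c : Polynomial ℕ) *
      (2 * Polynomial.X + 2) + 1 + t'.comp t))) fun I => ?_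
  have h := hp (DB.encodeInput relName constName I) 0 [] [] ⟨rfl, fun _ _ => rfl⟩
  rw [List.append_nil] at h
  -- The counter starts empty, so its final length is at most the time spent counting. Hence
  -- `t'.comp t` bounds the time for the output.
  have hN : DB.numerator relName constName q q.width (DB.encodeInput relName constName I) 0
      ≤ t.eval (DB.encodeInput relName constName I).length := by
    simpa [DB.Prog.cfg] using h.length_le DB.Stk.count
  refine (DB.Prog.Runs.seq (DB.Prog.runs_setup _ _) (DB.Prog.Runs.seq h (DB.Prog.Runs.seq
    (DB.Prog.runs_cleanup _ _ _) ((ht' _).mono (DB.eval_mono t' hN))))).of_eq ?_ ?_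
  · funext k
    cases k <;> simp [DB.Stk.all]
  · simp [c]
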